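/- Let $K\in\mathbb{R}\setminus\{0\}$ and $R>0$, with $R<\frac{\pi}{2\sqrt K}$ if $K>0$. There is a constant $C>0$ depending only on $R$ and $K$ such that the following holds. Let $\mathbb{M}$ be the $d$-dimensional space form of curvature $K$ (the sphere of radius $1/\sqrt K$ in $\mathbb{R}^{d+1}$ if $K>0$, the hyperbolic space of curvature $K$ if $K<0$), for any $d$, let $x_0\in\mathbb{M}$, let $\mathcal{M}=\operatorname{Exp}_{x_0}(\bar B(0,R))$ be the closed geodesic ball of radius $R$ around $x_0$, and let $L\ge\mu>0$ and $\varepsilon>0$. Then there is a deterministic adaptive algorithm that makes $$N\le C\,\sqrt{L/\mu}\;\max\{1,\log(L/\mu)\}\;\max\{1,\log(\mu/\varepsilon)\}$$ queries at points of $\mathcal{M}$ to a gradient oracle, that is, $N=O^*(\sqrt{L/\mu}\,\log(\mu/\varepsilon))$ where $O^*$ omits a $\log(L/\mu)$ factor and constants depending on $R$ and $K$, and that computes an $\varepsilon$-minimizer on $\mathcal{M}$ of every function $F$ satisfying the conditions below: when it is run with the oracle $x\mapsto\nabla F(x)$, its output $\hat x\in\mathcal{M}$ satisfies $F(\hat x)\le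 F(x)+\varepsilon$ for all $x\in\mathcal{M}$. The conditions on $F$ are: 1. $F$ is defined and differentiable on an open geodesic ball of some radius $R'>R$ around $x_0$; 2. for all $x,y\in\mathcal{M}$, with $\operatorname{Exp}_x^{-1}$ the inverse exponential map and $d(\cdot,\cdot)$ the geodesic distance, $$F(x)+\langle\nabla F(x),\operatorname{Exp}_x^{-1}(y)\rangle+\tfrac{\mu}{2}d(x,y)^2\;\le\;F(y)\;\le\;F(x)+\langle\nabla F(x),\operatorname{Exp}_x^{-1}(y)\rangle+\tfrac{L}{2}d(x,y)^2$$ (that is, $F$ is $L$-smooth and $\mu$-strongly g-convex on $\mathcal{M}$); 3. there is a point $x^\ast\in\mathcal{M}$ with $\nabla F(x^\ast)=0$, so that $d(x_0,x^\ast)\le R$. The algorithm may depend on $K,R,d,x_0,L,\mu,\varepsilon$, but not otherwise on $F$. -/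

import Mathlib

namespace ConstCurv

noncomputable section

/-- The ambient vector space `ℝ × ℝ^d` of the standard models of the `d`-dimensional sphere and of
the `d`-dimensional hyperbolic space (the hyperboloid model). -/
abbrev Ambient (d : ℕ) : Type := ℝ × EuclideanSpace ℝ (Fin d)

/-- The ambient bilinear form `sgn(K) a b + ⟨u, v⟩`: the Euclidean inner product of `ℝ^(d+1)` for
`K > 0`, the Lorentzian form for `K < 0`. On tangent spaces it is the Riemannian metric. -/
def form (K : ℝ) {d : ℕ} (X Y : Ambient d) : ℝ :=
  Real.sign K * X.1 * Y.1 + inner ℝ X.2 Y.2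

/-- The `d`-dimensional space form of constant sectional curvature `K ≠ 0`: for `K > 0` the round
sphere of radius `1/√K` in `ℝ^(d+1)`, for `K < 0` the upper sheet of the hyperboloid
`-a² + ‖u‖² = 1/K` in Lorentz space. -/
def SpaceForm (K : ℝ) (d : ℕ) : Type :=
  {X : Ambient d // form K X X = 1 / K ∧ (K < 0 → 0 < X.1)}

variable {K : ℝ} {d : ℕ}

/-- `C_K(√|K| d(x,y))`, where `C_K` is `cos` for `K > 0` and `cosh` for `K < 0`. -/
def cosDist (x y : SpaceForm K d) : ℝ := K * form K x.1 y.1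

/-- `√|K| d(x,y)`: the distance of `x` and `y` after rescaling to curvature `±1`. -/
def angle (x y : SpaceForm K d) : ℝ :=
  if 0 < K then Real.arccos (cosDist x y) else Real.arcosh (cosDist x y)

/-- The Riemannian (geodesic) distance. -/
def gdist (x y : SpaceForm K d) : ℝ := angle x y / √|K|

/-- The inverse exponential map `Exp_x⁻¹(y)`, a vector of the ambient space tangent at `x`: it has
norm `gdist x y` and the direction of the component of `y` orthogonal to `x`. (For antipodal points
of the sphere, where the inverse exponential map is not defined, the value is meaningless.) -/
def logMap (x y : SpaceForm K d) : Ambient d :=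
  (angle x y / (if 0 < K then Real.sin (angle x y) else Real.sinh (angle x y))) •
    (y.1 - cosDist x y • x.1)

/-- `g` is a tangent vector at `x`. -/
def IsTangent (x : SpaceForm K d) (g : Ambient d) : Prop := form K x.1 g = 0

/-- `F` is differentiable at `x` with Riemannian gradient `g ∈ T_x`:
`F(y) = F(x) + ⟨g, Exp_x⁻¹(y)⟩ + o(d(x,y))` as `y → x`. -/
def HasGradAt (F : SpaceForm K d → ℝ) (x : SpaceForm K d) (g : Ambient d) : Prop :=
  IsTangent x g ∧
    ∀ c : ℝ, 0 < c → ∃ δ : ℝ, 0 < δ ∧ ∀ y : SpaceForm K d, gdist x y < δ →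
      |F y - F x - form K g (logMap x y)| ≤ c * gdist x y

/-- The closed geodesic ball `Exp_{x₀}(B̄(0,R))`. -/
def closedBall (x₀ : SpaceForm K d) (R : ℝ) : Set (SpaceForm K d) := {x | gdist x₀ x ≤ R}

/-- `F`, with gradient field `G`, is `L`-smooth on `S`. -/
def IsSmoothOn (L : ℝ) (S : Set (SpaceForm K d)) (F : SpaceForm K d → ℝ)
    (G : SpaceForm K d → Ambient d) : Prop :=
  ∀ x ∈ S, ∀ y ∈ S, F y ≤ F x + form K (G x) (logMap x y) + L / 2 * gdist x y ^ 2

/-- `F`, with gradient field `G`, is `μ`-strongly geodesically convex on `S`. -/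
def IsStronglyGConvexOn (μ : ℝ) (S : Set (SpaceForm K d)) (F : SpaceForm K d → ℝ)
    (G : SpaceForm K d → Ambient d) : Prop :=
  ∀ x ∈ S, ∀ y ∈ S, F x + form K (G x) (logMap x y) + μ / 2 * gdist x y ^ 2 ≤ F y

end

/-- A deterministic adaptive algorithm that makes `numQueries` queries to an oracle `P → V`. The next
query point and, at the end, the output are functions of the list of the answers received so far
(the past query points are determined by these answers). -/
structure OracleAlgorithm (P V : Type) where
  numQueries : ℕ
  query : List V → P
  output : List V → P

/-- The list of the first `k` answers when the algorithm is run with the oracle `G`. -/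
def OracleAlgorithm.answers {P V : Type} (A : OracleAlgorithm P V) (G : P → V) : ℕ → List V
  | 0 => []
  | k + 1 => A.answers G k ++ [G (A.query (A.answers G k))]

/-- The output of the algorithm when it is run with the oracle `G`. -/
def OracleAlgorithm.run {P V : Type} (A : OracleAlgorithm P V) (G : P → V) : P :=
  A.output (A.answers G A.numQueries)

end ConstCurv

/-!
In the geodesic chart around `x₀` (gnomonic projection of the sphere, the Beltrami–Klein model of
hyperbolic space) geodesics are line segments and the geodesic ball is a Euclidean ball. For
`x = ψ u` and `y = ψ w`, the linear term `⟨∇F(y), Exp_y⁻¹(x)⟩` becomes `φ w u * ⟨g w, u - w⟩`, where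
`g` is the gradient in the chart and `φ` is an explicit positive function, pinched between constants
that depend on the curvature and the radius only, with `φ w u = 1 + O(‖u - w‖)`; the squared
geodesic distance is comparable to `‖u - w‖²` (`exists_chart`). Thus `F` becomes a "tilted convex"
function `f` on a Euclidean ball (`TiltedConvex`).

Since the gradient vanishes at a point of the ball, `f` has oscillation `O(L)` there, so `g` is
bounded by `O(L)`; the tilt is then a second-order effect, and `g` is Lipschitz with constant `O(L)`
(`TiltedConvex.lipschitz_grad`). Moreover `f` is strongly quasar-convex: with constants `a`, `m`,
`a (f w - f s) + (m / 2) ‖w - s‖² ≤ ⟨g w, w - s⟩` at the minimizer `s` (`TiltedConvex.quasar`).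

Acceleration needs in addition a bound of `⟨g z, z - v'⟩` by a multiple of `f x - f z`, for the new
point `z = (1 - l) x + l v'` on the segment from the current point `x` to the mirror point `v'`.
Convexity would give this bound with a fixed multiple. Here `z - v'` is a multiple of `x - z`, and
the tilted inequality gives the bound whatever the sign of the linear term, with a multiple that
depends on `φ z x`. As `φ` is known explicitly, it suffices to adapt the step length to `φ z x`, and
no line search is needed. The step length being known only together with `z`, an extragradient
method is used: a first gradient predicts `v'`, the gradient at `z` makes the actual step, and the
error of the prediction is absorbed thanks to the Lipschitz bound. Each iteration costs two queries
and contracts the potential `(a / m) (f x - f s) + ‖v - s‖² / 2` by a factor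
`1 + const * √(μ / L)` (`extragradient_step`, `TiltedConvex.accel_iterate`). All iterates stay in the
ball, as they are projections onto it or convex combinations of such. Hence `O(√(L / μ))` times the
logarithm of `L / ε = (L / μ) (μ / ε)` queries suffice (`exists_accel_algorithm`).
-/

namespace ConstCurv

/-! ### Tilted convex functions on a ball -/

section Acceleration

lemma norm_sub_sq_le {E : Type*} [NormedAddCommGroup E] {r : ℝ} {w u : E} (hw : ‖w‖ ≤ r)
    (hu : ‖u‖ ≤ r) : ‖u - w‖ ^ 2 ≤ 4 * r ^ 2 := by
  have h1 : ‖u - w‖ ≤ 2 * r := (norm_sub_le u w).trans (by linarith)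
  nlinarith [norm_nonneg (u - w)]

variable {E : Type*} [NormedAddCommGroup E] [InnerProductSpace ℝ E]

/-- `f`, with the vector field `g` in the role of its gradient, is `L`-smooth and `μ`-strongly convex
on the ball of radius `r` up to the distortion of a chart: the linear term is rescaled by the
positive factor `φ`, and `D` replaces the squared distance. The bounds say that `φ` is comparable
to `1`, tends to `1` on the diagonal at a linear rate, and that `D` is comparable to the squared
norm distance. -/
structure TiltedConvex (r c₁ c₂ c₃ c₄ c₅ L μ : ℝ) (φ D : E → E → ℝ) (f : E → ℝ) (g : E → E) :
    Prop where
  lower : ∀ w u, ‖w‖ ≤ r → ‖u‖ ≤ r → f w + φ w u * inner ℝ (g w) (u - w) + μ / 2 * D w u ≤ f u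
  upper : ∀ w u, ‖w‖ ≤ r → ‖u‖ ≤ r → f u ≤ f w + φ w u * inner ℝ (g w) (u - w) + L / 2 * D w u
  le_tilt : ∀ w u, ‖w‖ ≤ r → ‖u‖ ≤ r → c₁ ≤ φ w u
  tilt_le : ∀ w u, ‖w‖ ≤ r → ‖u‖ ≤ r → φ w u ≤ c₂
  tilt_sub_one : ∀ w u, ‖w‖ ≤ r → ‖u‖ ≤ r → |φ w u - 1| ≤ c₃ * ‖u - w‖
  le_dist : ∀ w u, ‖w‖ ≤ r → ‖u‖ ≤ r → c₄ * ‖u - w‖ ^ 2 ≤ D w u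
  dist_le : ∀ w u, ‖w‖ ≤ r → ‖u‖ ≤ r → D w u ≤ c₅ * ‖u - w‖ ^ 2

/-- A vector is controlled by the oscillation over the ball of radius `r` of the linear functional
that it defines. -/
lemma norm_le_of_inner_sub_le {r M : ℝ} (hr : 0 < r) (h : E)
    (hM : ∀ u, ‖u‖ ≤ r → ∀ u', ‖u'‖ ≤ r → inner ℝ h (u - u') ≤ 2 * M) : r * ‖h‖ ≤ M := by
  rcases eq_or_ne h 0 with rfl | hh
  · have := hM 0 (by simpa using hr.le) 0 (by simpa using hr.le)
    simp at this ⊢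
    linarith
  have hn : 0 < ‖h‖ := norm_pos_iff.mpr hh
  have hu : ‖(r / ‖h‖) • h‖ ≤ r := by
    rw [norm_smul, Real.norm_of_nonneg (by positivity), div_mul_cancel₀ _ hn.ne']
  have := hM _ hu (-((r / ‖h‖) • h)) (by rwa [norm_neg])
  rw [sub_neg_eq_add, inner_add_right, inner_smul_right, real_inner_self_eq_norm_sq] at this
  have e : r / ‖h‖ * ‖h‖ ^ 2 = r * ‖h‖ := by field_simp
  linarith

namespace TiltedConvex

variable {r c₁ c₂ c₃ c₄ c₅ L μ : ℝ} {φ D : E → E → ℝ} {f : E → ℝ} {g : E → E}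

lemma min_le (h : TiltedConvex r c₁ c₂ c₃ c₄ c₅ L μ φ D f g) (hμ : 0 < μ) (h4 : 0 < c₄)
    {s u : E} (hs : ‖s‖ ≤ r) (hgs : g s = 0) (hu : ‖u‖ ≤ r) : f s ≤ f u := by
  have h1 := h.lower s u hs hu
  have h2 := h.le_dist s u hs hu
  rw [hgs, inner_zero_left, mul_zero] at h1
  have : 0 ≤ D s u := le_trans (by positivity) h2
  have : 0 ≤ μ / 2 * D s u := by positivity
  linarith

lemma le_min_add (h : TiltedConvex r c₁ c₂ c₃ c₄ c₅ L μ φ D f g) (hL : 0 < L) (h5 : 0 < c₅)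
    {s u : E} (hs : ‖s‖ ≤ r) (hgs : g s = 0) (hu : ‖u‖ ≤ r) : f u ≤ f s + 2 * L * c₅ * r ^ 2 := by
  have h1 := h.upper s u hs hu
  have h2 := h.dist_le s u hs hu
  rw [hgs, inner_zero_left, mul_zero] at h1
  have h3 : c₅ * ‖u - s‖ ^ 2 ≤ c₅ * (4 * r ^ 2) :=
    mul_le_mul_of_nonneg_left (norm_sub_sq_le hs hu) h5.le
  have h4 : L / 2 * D s u ≤ L / 2 * (c₅ * (4 * r ^ 2)) :=
    mul_le_mul_of_nonneg_left (h2.trans h3) (by positivity)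
  linarith

lemma norm_grad_le (h : TiltedConvex r c₁ c₂ c₃ c₄ c₅ L μ φ D f g) (hr : 0 < r) (hL : 0 < L)
    (hμ : 0 < μ) (h1 : 0 < c₁) (h4 : 0 < c₄) (h5 : 0 < c₅)
    {s w : E} (hs : ‖s‖ ≤ r) (hgs : g s = 0) (hw : ‖w‖ ≤ r) : ‖g w‖ ≤ 4 * L * c₅ * r / c₁ := by
  have key : ∀ u, ‖u‖ ≤ r → |inner ℝ (g w) (u - w)| ≤ 4 * L * c₅ * r ^ 2 / c₁ := by
    intro u hu
    have a1 := h.lower w u hw hu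
    have a2 := h.upper w u hw hu
    have a3 := h.min_le hμ h4 hs hgs hu
    have a4 := h.min_le hμ h4 hs hgs hw
    have a5 := h.le_min_add hL h5 hs hgs hu
    have a6 := h.le_min_add hL h5 hs hgs hw
    have a7 := h.le_tilt w u hw hu
    have a8 : 0 ≤ D w u := le_trans (by positivity) (h.le_dist w u hw hu)
    have a9 : L / 2 * D w u ≤ L / 2 * (c₅ * (4 * r ^ 2)) :=
      mul_le_mul_of_nonneg_left ((h.dist_le w u hw hu).trans
        (mul_le_mul_of_nonneg_left (norm_sub_sq_le hw hu) h5.le)) (by positivity)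
    have a10 : 0 ≤ μ / 2 * D w u := by positivity
    have a11 : 0 ≤ L * c₅ * r ^ 2 := by positivity
    have a12 : |φ w u * inner ℝ (g w) (u - w)| ≤ 4 * L * c₅ * r ^ 2 :=
      abs_le.mpr ⟨by linarith, by linarith⟩
    rw [abs_mul, abs_of_pos (h1.trans_le a7)] at a12
    rw [le_div_iff₀ h1, mul_comm]
    exact (mul_le_mul_of_nonneg_right a7 (abs_nonneg _)).trans a12
  have := norm_le_of_inner_sub_le (M := 4 * L * c₅ * r ^ 2 / c₁) hr (g w) (fun u hu u' hu' => by
    have e : u - u' = (u - w) - (u' - w) := by abel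
    rw [e, inner_sub_right]
    have := abs_le.mp (key u hu)
    have := abs_le.mp (key u' hu')
    linarith)
  refine le_of_mul_le_mul_left (this.trans_eq ?_) hr
  ring

/-- The distortion of the linear term is a second-order effect, because the gradient is bounded:
in the chart, the gradient gives a first-order expansion with a quadratic remainder. -/
lemma abs_sub_linear_le (h : TiltedConvex r c₁ c₂ c₃ c₄ c₅ L μ φ D f g) (hr : 0 < r) (hL : 0 < L)
    (hμ : 0 < μ) (h1 : 0 < c₁) (h3 : 0 < c₃) (h4 : 0 < c₄) (h5 : 0 < c₅)
    {s w u : E} (hs : ‖s‖ ≤ r) (hgs : g s = 0) (hw : ‖w‖ ≤ r) (hu : ‖u‖ ≤ r) :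
    |f u - f w - inner ℝ (g w) (u - w)| ≤ L * (4 * c₃ * c₅ * r / c₁ + c₅) * ‖u - w‖ ^ 2 := by
  have b1 : |(φ w u - 1) * inner ℝ (g w) (u - w)| ≤
      (c₃ * ‖u - w‖) * (4 * L * c₅ * r / c₁ * ‖u - w‖) := by
    rw [abs_mul]
    refine mul_le_mul (h.tilt_sub_one w u hw hu) ?_ (abs_nonneg _) (by positivity)
    exact (abs_real_inner_le_norm _ _).trans (mul_le_mul_of_nonneg_right
      (h.norm_grad_le hr hL hμ h1 h4 h5 hs hgs hw) (norm_nonneg _))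
  have e : (c₃ * ‖u - w‖) * (4 * L * c₅ * r / c₁ * ‖u - w‖) =
      L * (4 * c₃ * c₅ * r / c₁) * ‖u - w‖ ^ 2 := by ring
  rw [e] at b1
  have a1 := h.lower w u hw hu
  have a2 := h.upper w u hw hu
  have a8 : 0 ≤ D w u := le_trans (by positivity) (h.le_dist w u hw hu)
  have a9 : L / 2 * D w u ≤ L / 2 * (c₅ * ‖u - w‖ ^ 2) :=
    mul_le_mul_of_nonneg_left (h.dist_le w u hw hu) (by positivity)
  have a10 : 0 ≤ μ / 2 * D w u := by positivity
  have a11 : 0 ≤ L * c₅ * ‖u - w‖ ^ 2 := by positivity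
  have := abs_le.mp b1
  rw [abs_le]
  constructor <;> nlinarith

/-- The gradient is Lipschitz on the whole ball, up to the boundary: the expansions at two
points `y`, `z` are compared at the points of a small homothetic copy of the ball that contains `y`
and lies inside the ball. -/
lemma lipschitz_grad (h : TiltedConvex r c₁ c₂ c₃ c₄ c₅ L μ φ D f g) (hr : 0 < r) (hL : 0 < L)
    (hμ : 0 < μ) (h1 : 0 < c₁) (h3 : 0 < c₃) (h4 : 0 < c₄) (h5 : 0 < c₅)
    {s y z : E} (hs : ‖s‖ ≤ r) (hgs : g s = 0) (hy : ‖y‖ ≤ r) (hz : ‖z‖ ≤ r) :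
    ‖g y - g z‖ ≤ 12 * (L * (4 * c₃ * c₅ * r / c₁ + c₅)) * ‖y - z‖ := by
  rcases eq_or_ne y z with rfl | hne
  · simp
  set Q := L * (4 * c₃ * c₅ * r / c₁ + c₅) with hQ
  have hQ0 : 0 < Q := by positivity
  set δ := ‖y - z‖ with hδ
  have hδ0 : 0 < δ := norm_pos_iff.mpr (sub_ne_zero.mpr hne)
  have hδr : δ ≤ 2 * r := (norm_sub_le y z).trans (by linarith)
  have exp : ∀ {w u : E}, ‖w‖ ≤ r → ‖u‖ ≤ r →
      |f u - f w - inner ℝ (g w) (u - w)| ≤ Q * ‖u - w‖ ^ 2 := fun hw hu =>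
    h.abs_sub_linear_le hr hL hμ h1 h3 h4 h5 hs hgs hw hu
  set t := δ / (2 * r) with ht
  have ht0 : 0 < t := by positivity
  have ht1 : t ≤ 1 := by rw [ht, div_le_one (by positivity)]; exact hδr
  have htr : t * (2 * r) = δ := by rw [ht]; field_simp
  have key : ∀ u, ‖u‖ ≤ r → |inner ℝ (g y - g z) (t • (u - y))| ≤ 6 * Q * δ ^ 2 := by
    intro u hu
    set w := y + t • (u - y) with hw
    have hwr : ‖w‖ ≤ r := by
      have e : w = (1 - t) • y + t • u := by rw [hw]; module
      rw [e]
      refine (norm_add_le _ _).trans ?_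
      rw [norm_smul, norm_smul, Real.norm_of_nonneg ht0.le, Real.norm_of_nonneg (by linarith)]
      nlinarith
    have hwy : ‖w - y‖ ≤ δ := by
      rw [hw, add_sub_cancel_left, norm_smul, Real.norm_of_nonneg ht0.le, ← htr]
      exact mul_le_mul_of_nonneg_left ((norm_sub_le _ _).trans (by linarith)) ht0.le
    have hwz : ‖w - z‖ ≤ 2 * δ := by
      have e : w - z = (w - y) + (y - z) := by abel
      rw [e]
      exact (norm_add_le _ _).trans (by linarith)
    have e1 := abs_le.mp (exp hy hwr)
    have e2 := abs_le.mp (exp hz hwr)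
    have e3 := abs_le.mp (exp hz hy)
    have n1 : Q * ‖w - y‖ ^ 2 ≤ Q * δ ^ 2 := by gcongr
    have n2 : Q * ‖w - z‖ ^ 2 ≤ Q * (2 * δ) ^ 2 := by gcongr
    have i1 : inner ℝ (g z) (w - z) = inner ℝ (g z) (w - y) + inner ℝ (g z) (y - z) := by
      rw [← inner_add_right]; congr 1; abel
    have i2 : t • (u - y) = w - y := by rw [hw]; abel
    rw [i2, inner_sub_left, abs_le]
    constructor <;> nlinarith
  have := norm_le_of_inner_sub_le (M := 6 * Q * δ ^ 2 / t) hr (g y - g z) (fun u hu u' hu' => by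
    have e : t • (u - u') = t • (u - y) - t • (u' - y) := by module
    have e2 : t * inner ℝ (g y - g z) (u - u') =
        inner ℝ (g y - g z) (t • (u - y)) - inner ℝ (g y - g z) (t • (u' - y)) := by
      rw [← inner_sub_right, ← e, inner_smul_right]
    have := abs_le.mp (key u hu)
    have := abs_le.mp (key u' hu')
    rw [← mul_div_assoc, le_div_iff₀ ht0, mul_comm, e2]
    linarith)
  rw [le_div_iff₀ ht0] at this
  have e : r * ‖g y - g z‖ * t = δ * ‖g y - g z‖ / 2 := by rw [← htr]; ring
  rw [e] at this
  refine le_of_mul_le_mul_left ?_ hδ0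
  nlinarith

/-- Strong quasar-convexity at the minimizer `s`. -/
lemma quasar (h : TiltedConvex r c₁ c₂ c₃ c₄ c₅ L μ φ D f g) (hμ : 0 < μ) (h1 : 0 < c₁)
    (h4 : 0 < c₄) {s w : E} (hs : ‖s‖ ≤ r) (hgs : g s = 0) (hw : ‖w‖ ≤ r) :
    1 / c₂ * (f w - f s) + μ * c₄ / c₂ / 2 * ‖w - s‖ ^ 2 ≤ inner ℝ (g w) (w - s) := by
  have a1 := h.lower w s hw hs
  have a2 := h.min_le hμ h4 hs hgs hw
  have a3 := h.le_tilt w s hw hs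
  have a4 := h.tilt_le w s hw hs
  have a5 := h.le_dist w s hw hs
  have e : inner ℝ (g w) (s - w) = - inner ℝ (g w) (w - s) := by
    rw [← inner_neg_right, neg_sub]
  have hc2 : 0 < c₂ := by linarith
  have a6 : μ / 2 * (c₄ * ‖s - w‖ ^ 2) ≤ μ / 2 * D w s :=
    mul_le_mul_of_nonneg_left a5 (by positivity)
  rw [e] at a1
  rw [norm_sub_rev] at a6
  set I := inner ℝ (g w) (w - s)
  have a7 : (f w - f s) + μ / 2 * (c₄ * ‖w - s‖ ^ 2) ≤ φ w s * I := by linarith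
  have hI : 0 ≤ I := by
    have : 0 ≤ φ w s * I := le_trans (by have : 0 ≤ f w - f s := by linarith
                                         positivity) a7
    exact nonneg_of_mul_nonneg_right this (by linarith)
  have a8 : φ w s * I ≤ c₂ * I := mul_le_mul_of_nonneg_right a4 hI
  have : 1 / c₂ * (f w - f s) + μ * c₄ / c₂ / 2 * ‖w - s‖ ^ 2 =
      ((f w - f s) + μ / 2 * (c₄ * ‖w - s‖ ^ 2)) / c₂ := by field_simp
  rw [this, div_le_iff₀ hc2]
  linarith

end TiltedConvex

/-! ### A step of the accelerated extragradient method -/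

/-- The defining property of a nearest-point map `P` of the ball of radius `r`. -/
def IsBallProj (r : ℝ) (P : E → E) : Prop :=
  ∀ p, ‖P p‖ ≤ r ∧ ∀ u, ‖u‖ ≤ r → inner ℝ (p - P p) (u - P p) ≤ 0

lemma exists_isBallProj [CompleteSpace E] {r : ℝ} (hr : 0 < r) : ∃ P : E → E, IsBallProj r P := by
  have hc : Convex ℝ (Metric.closedBall (0 : E) r) := convex_closedBall 0 r
  have : ∀ p : E, ∃ v, ‖v‖ ≤ r ∧ ∀ u, ‖u‖ ≤ r → inner ℝ (p - v) (u - v) ≤ 0 := by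
    intro p
    obtain ⟨v, hv, h⟩ := exists_norm_eq_iInf_of_complete_convex
      (K := Metric.closedBall (0 : E) r) ⟨0, by simpa using hr.le⟩
      Metric.isClosed_closedBall.isComplete hc p
    have := (norm_eq_iInf_iff_real_inner_le_zero hc hv).mp h
    exact ⟨v, by simpa using hv, fun u hu => this u (by simpa using hu)⟩
  choose P hP using this
  exact ⟨P, hP⟩

/-- One step of the accelerated extragradient method contracts the potential
`A (f - f s) + ‖v - s‖² / 2`. The gradient `gy` at the extrapolated point `y` only serves to predict
the point `z`; the step is an implicit one up to the error `‖gz - gy‖`, which the Lipschitz bound and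
the two negative quadratic terms of the prediction absorb. The step length `η` depends on
the tilt `p` between `z` and `x`, in such a way that the linear term
`⟨gz, z - v'⟩` is bounded by `A / η * (f x - f z)` whatever its sign. -/
lemma extragradient_step {x v y v' z vp s gy gz : E} {fx fz fs a m Lip p c₂ l A η η' : ℝ}
    (ha : 0 < a) (hm : 0 < m) (hp : 0 < p) (hpc : p ≤ c₂) (hl0 : 0 < l)
    (hl1 : l < 1) (hA : A = a / m) (hη : η = A * l * p / (1 - l)) (hη' : η' = A * l * c₂ / (1 - l))
    (hLip : Lip * l * η' ≤ 1)
    (hy : y = (1 - l) • x + l • v) (hz : z = (1 - l) • x + l • v')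
    (hg : ‖gz - gy‖ ≤ Lip * ‖z - y‖)
    (htilt : p * inner ℝ gz (x - z) ≤ fx - fz)
    (hquasar : a * (fz - fs) + m / 2 * ‖z - s‖ ^ 2 ≤ inner ℝ gz (z - s))
    (hv' : inner ℝ (v - η' • gy - v') (vp - v') ≤ 0)
    (hvp : inner ℝ ((1 + η * m)⁻¹ • (v + (η * m) • z - η • gz) - vp) (s - vp) ≤ 0) :
    (1 + η * m) * (A * (fz - fs) + ‖vp - s‖ ^ 2 / 2) ≤ A * (fx - fs) + ‖v - s‖ ^ 2 / 2 := by
  have h1l : 0 < 1 - l := by linarith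
  have hA0 : 0 < A := by rw [hA]; positivity
  have hη0 : 0 < η := by rw [hη]; positivity
  have hc2 : 0 < c₂ := by linarith
  have hη'0 : 0 < η' := by rw [hη']; positivity
  have hηη' : η ≤ η' := by rw [hη, hη']; gcongr
  have hAm : A * m = a := by rw [hA]; field_simp
  -- the linear term between `z` and `v'`
  have s2 : η * inner ℝ gz (z - v') ≤ A * (fx - fz) := by
    have e : l • (z - v') = (1 - l) • (x - z) := by rw [hz]; module
    have e2 : l * inner ℝ gz (z - v') = (1 - l) * inner ℝ gz (x - z) := by
      rw [← inner_smul_right, e, inner_smul_right]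
    have e3 : η * inner ℝ gz (z - v') = A * (p * inner ℝ gz (x - z)) := by
      have : η * inner ℝ gz (z - v') = A * p / (1 - l) * (l * inner ℝ gz (z - v')) := by
        rw [hη]; ring
      rw [this, e2]; field_simp
    rw [e3]
    exact mul_le_mul_of_nonneg_left htilt hA0.le
  -- the prediction error
  have s3 : inner ℝ (gz - gy) (v' - vp) ≤ Lip * l * (‖v' - v‖ * ‖v' - vp‖) := by
    have e : z - y = l • (v' - v) := by rw [hz, hy]; module
    rw [e, norm_smul, Real.norm_of_nonneg hl0.le] at hg
    refine (real_inner_le_norm _ _).trans ?_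
    refine (mul_le_mul_of_nonneg_right hg (norm_nonneg _)).trans_eq (by ring)
  have s3' : η' * inner ℝ gy (v' - vp) ≤
      (‖v - vp‖ ^ 2 - ‖v' - v‖ ^ 2 - ‖v' - vp‖ ^ 2) / 2 := by
    have e1 : v - η' • gy - v' = (v - v') - η' • gy := by abel
    have e2 : v - vp = (v - v') - (vp - v') := by abel
    have e3 : v' - vp = -(vp - v') := by abel
    rw [e1, inner_sub_left, inner_smul_left] at hv'
    have n1 := norm_sub_sq_real (v - v') (vp - v')
    rw [e2, e3, inner_neg_right, norm_neg, norm_sub_rev v' v]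
    simp only [RCLike.conj_to_real] at hv'
    linarith
  have s4 : η * inner ℝ gz (vp - s) ≤ (‖v - s‖ ^ 2 - ‖v - vp‖ ^ 2 - ‖vp - s‖ ^ 2) / 2 +
      η * m / 2 * (‖z - s‖ ^ 2 - ‖vp - s‖ ^ 2) := by
    have h0 : 0 < 1 + η * m := by positivity
    have e1 : (1 + η * m)⁻¹ • (v + (η * m) • z - η • gz) - vp =
        (1 + η * m)⁻¹ • ((v - vp) + (η * m) • (z - vp) - η • gz) := by
      have : vp = (1 + η * m)⁻¹ • ((1 + η * m) • vp) := by rw [inv_smul_smul₀ h0.ne']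
      nth_rewrite 1 [this]
      rw [← smul_sub]
      congr 1
      module
    rw [e1, inner_smul_left] at hvp
    simp only [RCLike.conj_to_real] at hvp
    have h2 : inner ℝ ((v - vp) + (η * m) • (z - vp) - η • gz) (s - vp) ≤ 0 :=
      nonpos_of_mul_nonpos_right hvp (by positivity)
    rw [inner_sub_left, inner_add_left, inner_smul_left, inner_smul_left] at h2
    simp only [RCLike.conj_to_real] at h2
    have n1 := norm_sub_sq_real (v - vp) (s - vp)
    have n2 := norm_sub_sq_real (z - vp) (s - vp)
    have e2 : v - vp - (s - vp) = v - s := by abel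
    have e3 : z - vp - (s - vp) = z - s := by abel
    have e4 : vp - s = -(s - vp) := by abel
    rw [e2] at n1
    rw [e3] at n2
    rw [e4, inner_neg_right, norm_neg]
    have hp2 : 0 ≤ η * m * ‖z - vp‖ ^ 2 := by positivity
    have n3 : η * m * ‖z - s‖ ^ 2 =
        η * m * (‖z - vp‖ ^ 2 - 2 * inner ℝ (z - vp) (s - vp) + ‖s - vp‖ ^ 2) := by rw [n2]
    linarith
  -- the prediction terms add up to a nonpositive quantity
  have s5 : η * inner ℝ gz (v' - vp) ≤ ‖v - vp‖ ^ 2 / 2 := by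
    have e : inner ℝ gz (v' - vp) = inner ℝ (gz - gy) (v' - vp) + inner ℝ gy (v' - vp) := by
      rw [← inner_add_left, sub_add_cancel]
    have t1 : η' * inner ℝ gz (v' - vp) ≤ ‖v - vp‖ ^ 2 / 2 := by
      have t2 : η' * inner ℝ (gz - gy) (v' - vp) ≤ ‖v' - v‖ * ‖v' - vp‖ := by
        have := mul_le_mul_of_nonneg_left s3 hη'0.le
        have h0 : 0 ≤ ‖v' - v‖ * ‖v' - vp‖ := by positivity
        have := mul_le_mul_of_nonneg_right hLip h0
        linarith
      rw [e, mul_add]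
      nlinarith [sq_nonneg (‖v' - v‖ - ‖v' - vp‖)]
    rcases le_total 0 (inner ℝ gz (v' - vp)) with h0 | h0
    · exact (mul_le_mul_of_nonneg_right hηη' h0).trans t1
    · have : η * inner ℝ gz (v' - vp) ≤ 0 := mul_nonpos_of_nonneg_of_nonpos hη0.le h0
      exact this.trans (by positivity)
  have s6 : inner ℝ gz (z - s) =
      inner ℝ gz (z - v') + inner ℝ gz (v' - vp) + inner ℝ gz (vp - s) := by
    rw [← inner_add_right, ← inner_add_right]; congr 1; abel
  have s7 := mul_le_mul_of_nonneg_left hquasar hη0.le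
  rw [s6] at s7
  have s8 : η * m * (A * (fz - fs)) = η * (a * (fz - fs)) := by rw [← hAm]; ring
  nlinarith

end Acceleration

section Geometry

/-! ### Comparison of arcs and half-chords -/

lemma sinh_le_two_mul_mul_cosh {t : ℝ} (ht : 0 ≤ t) : Real.sinh t ≤ 2 * t * Real.cosh t := by
  rw [Real.sinh_eq, Real.cosh_eq]
  have h1 : 1 - 2 * t ≤ Real.exp (-t) * Real.exp (-t) := by
    rw [← Real.exp_add]
    have := Real.add_one_le_exp (-t + -t)
    linarith
  have h2 : Real.exp t * Real.exp (-t) = 1 := by rw [← Real.exp_add]; simp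
  have h3 := Real.exp_pos t
  have h4 := Real.exp_pos (-t)
  have h5 : Real.exp t * (1 - 2 * t) ≤ Real.exp (-t) := by
    calc _ ≤ Real.exp t * (Real.exp (-t) * Real.exp (-t)) := mul_le_mul_of_nonneg_left h1 h3.le
      _ = _ := by rw [← mul_assoc, h2, one_mul]
  have h6 : 0 ≤ t * Real.exp (-t) := by positivity
  linarith

lemma sinh_sub_self_le {t : ℝ} (ht : 0 ≤ t) : Real.sinh t - t ≤ t * Real.sinh t := by
  have h0 : 0 ≤ Real.sinh t := Real.sinh_nonneg_iff.mpr ht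
  rcases le_total 1 t with h | h
  · nlinarith
  have h1 : (1 - t) * Real.exp t ≤ 1 := by
    have := Real.one_sub_le_exp_neg t
    calc _ ≤ Real.exp (-t) * Real.exp t := mul_le_mul_of_nonneg_right this (Real.exp_pos t).le
      _ = 1 := by rw [← Real.exp_add]; simp
  have h2 : (1 - t) * (1 - t) ≤ (1 - t) * Real.exp (-t) :=
    mul_le_mul_of_nonneg_left (Real.one_sub_le_exp_neg t) (by linarith)
  rw [Real.sinh_eq]
  nlinarith

lemma sub_sin_le_sq {t : ℝ} (ht : 0 ≤ t) (ht' : t ≤ Real.pi) : t - Real.sin t ≤ t ^ 2 := by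
  rcases ht.eq_or_lt with rfl | h0
  · simp
  have hs := Real.sin_nonneg_of_nonneg_of_le_pi ht ht'
  rcases le_total 1 t with h | h
  · nlinarith
  · have := Real.sin_gt_sub_cube h0
    nlinarith [sq_nonneg t]

/-- Away from the antipodal point, an arc is at most a constant times its half-chord. -/
lemma le_mul_sin {t c : ℝ} (hc : 0 < c) (ht : 0 ≤ t) (ht' : t ≤ Real.pi)
    (h : 2 * c ^ 2 ≤ 1 + Real.cos t) : t ≤ Real.pi / (2 * c) * Real.sin t := by
  have h1 : 0 ≤ Real.cos (t / 2) := Real.cos_nonneg_of_mem_Icc ⟨by linarith, by linarith⟩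
  have e : Real.cos t = 2 * Real.cos (t / 2) ^ 2 - 1 := by
    rw [← Real.cos_two_mul]; congr 1; ring
  have e' : Real.sin t = 2 * Real.sin (t / 2) * Real.cos (t / 2) := by
    rw [← Real.sin_two_mul]; congr 1; ring
  have h2 : c ≤ Real.cos (t / 2) := by
    refine le_of_sq_le_sq ?_ h1
    linarith
  have h3 := Real.mul_le_sin (x := t / 2) (by linarith) (by linarith)
  have hp := Real.pi_pos
  have h4 : t ≤ Real.pi * Real.sin (t / 2) := by
    have : 2 / Real.pi * (t / 2) = t / Real.pi := by ring
    rw [this, div_le_iff₀ hp] at h3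
    linarith
  have h5 : 0 ≤ Real.sin (t / 2) := by
    by_contra hn
    nlinarith
  rw [e', div_mul_eq_mul_div, le_div_iff₀ (by positivity)]
  calc t * (2 * c) ≤ (Real.pi * Real.sin (t / 2)) * (2 * c) := by gcongr
    _ ≤ (Real.pi * Real.sin (t / 2)) * (2 * Real.cos (t / 2)) := by gcongr
    _ = _ := by ring

/-- The generalized sine of curvature `K`, rescaled to curvature `±1`. -/
noncomputable def genSin (K t : ℝ) : ℝ := if 0 < K then Real.sin t else Real.sinh t

/-- The inverse of the generalized cosine, rescaled to curvature `±1`. -/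
noncomputable def genArccos (K q : ℝ) : ℝ := if 0 < K then Real.arccos q else Real.arcosh q

/-- The generalized cosine, rescaled to curvature `±1`. -/
noncomputable def genCos (K t : ℝ) : ℝ := if 0 < K then Real.cos t else Real.cosh t

/-- Uniform comparison of the angle `t` with its generalized sine, on the range of angles that
occur in the ball whose boundary has generalized cosine `c`. -/
lemma exists_genSin_bounds (K c : ℝ) (hK : K ≠ 0) (hc : 0 < c) (hc1 : 0 < K → c ≤ 1)
    (hc2 : K < 0 → 1 ≤ c) : ∃ s₁ s₂ s₃ : ℝ, 0 < s₁ ∧ s₁ ≤ 1 ∧ 1 ≤ s₂ ∧ 0 < s₃ ∧ ∀ q : ℝ,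
      (0 < K → 2 * c ^ 2 ≤ 1 + q ∧ q ≤ 1) → (K < 0 → 1 ≤ q ∧ q ≤ 2 * c ^ 2) →
      0 ≤ genArccos K q ∧ 0 ≤ genSin K (genArccos K q) ∧
      genSin K (genArccos K q) ^ 2 = |1 - q ^ 2| ∧
      s₁ * genSin K (genArccos K q) ≤ genArccos K q ∧
      genArccos K q ≤ s₂ * genSin K (genArccos K q) ∧
      |genArccos K q - genSin K (genArccos K q)| ≤
        s₃ * (genArccos K q * genSin K (genArccos K q)) := by
  rcases hK.lt_or_gt with hK | hK
  · have h1 := hc2 hK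
    refine ⟨1 / (4 * c ^ 2), 1, 1, by positivity, ?_, le_rfl, one_pos, ?_⟩
    · rw [div_le_one (by positivity)]; nlinarith
    intro q _ hq
    obtain ⟨hq1, hq2⟩ := hq hK
    simp only [genArccos, genSin, if_neg hK.not_gt]
    set t := Real.arcosh q with ht
    have ht0 : 0 ≤ t := Real.arcosh_nonneg hq1
    have hct : Real.cosh t = q := Real.cosh_arcosh hq1
    have hs0 : 0 ≤ Real.sinh t := Real.sinh_nonneg_iff.mpr ht0
    have hst : t ≤ Real.sinh t := Real.self_le_sinh_iff.mpr ht0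
    refine ⟨ht0, hs0, ?_, ?_, by linarith, ?_⟩
    · rw [Real.sinh_sq, hct, abs_sub_comm, abs_of_nonneg (by nlinarith)]
    · have := sinh_le_two_mul_mul_cosh ht0
      rw [hct] at this
      rw [div_mul_eq_mul_div, div_le_iff₀ (by positivity)]
      nlinarith
    · rw [abs_sub_comm, abs_of_nonneg (by linarith), one_mul]
      exact sinh_sub_self_le ht0
  · have h1 := hc1 hK
    have hp := Real.pi_gt_three
    refine ⟨1, Real.pi / (2 * c), Real.pi / (2 * c), one_pos, le_rfl, ?_, by positivity, ?_⟩
    · rw [le_div_iff₀ (by positivity)]; linarith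
    intro q hq _
    obtain ⟨hq1, hq2⟩ := hq hK
    simp only [genArccos, genSin, if_pos hK]
    set t := Real.arccos q with ht
    have ht0 : 0 ≤ t := Real.arccos_nonneg q
    have htp : t ≤ Real.pi := Real.arccos_le_pi q
    have hqm : -1 ≤ q := by nlinarith
    have hct : Real.cos t = q := Real.cos_arccos hqm hq2
    have hs0 : 0 ≤ Real.sin t := Real.sin_nonneg_of_nonneg_of_le_pi ht0 htp
    have hst : Real.sin t ≤ t := Real.sin_le ht0
    have hts := le_mul_sin hc ht0 htp (by rw [hct]; exact hq1)
    refine ⟨ht0, hs0, ?_, by linarith, hts, ?_⟩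
    · rw [Real.sin_sq, hct, abs_of_nonneg (by nlinarith)]
    · rw [abs_of_nonneg (by linarith)]
      have := sub_sin_le_sq ht0 htp
      nlinarith

/-! ### The ambient form and frames -/

variable {K : ℝ} {d : ℕ}

lemma form_comm (X Y : Ambient d) : form K X Y = form K Y X := by
  simp only [form, real_inner_comm]; ring

lemma form_add_right (X Y Z : Ambient d) : form K X (Y + Z) = form K X Y + form K X Z := by
  simp only [form, Prod.fst_add, Prod.snd_add, inner_add_right]; ring

lemma form_smul_right (c : ℝ) (X Y : Ambient d) : form K X (c • Y) = c * form K X Y := by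
  simp only [form, Prod.smul_fst, Prod.smul_snd, inner_smul_right, smul_eq_mul]; ring

lemma form_sub_right (X Y Z : Ambient d) : form K X (Y - Z) = form K X Y - form K X Z := by
  simp only [form, Prod.fst_sub, Prod.snd_sub, inner_sub_right]; ring

lemma form_add_left (X Y Z : Ambient d) : form K (X + Y) Z = form K X Z + form K Y Z := by
  rw [form_comm, form_add_right, form_comm, form_comm Z Y]

lemma form_smul_left (c : ℝ) (X Y : Ambient d) : form K (c • X) Y = c * form K X Y := by
  rw [form_comm, form_smul_right, form_comm]

lemma mul_form_self (hK : K ≠ 0) (x : SpaceForm K d) : K * form K x.1 x.1 = 1 := by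
  rw [x.2.1]; field_simp

/-- An orthonormal frame of the tangent space at `x`: an isometric linear map `J` from `ℝ^d` onto
the tangent space, with its adjoint `A`. It is the restriction to the tangent space at the pole of
the reflection that exchanges `x` with plus or minus the pole, where the sign is chosen such that no
denominator can vanish. -/
lemma exists_frame (hK : K ≠ 0) (x : SpaceForm K d) :
    ∃ (J : EuclideanSpace ℝ (Fin d) →ₗ[ℝ] Ambient d) (A : Ambient d → EuclideanSpace ℝ (Fin d)),
      (∀ u v, form K (J u) (J v) = inner ℝ u v) ∧ (∀ u, form K x.1 (J u) = 0) ∧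
      (∀ Z, form K x.1 Z = 0 → ∃ u, J u = Z) ∧ (∀ G u, inner ℝ (A G) u = form K G (J u)) := by
  set k := √|K| with hk
  have hk2 : k ^ 2 = |K| := Real.sq_sqrt (abs_nonneg K)
  have hk0 : 0 < k := Real.sqrt_pos.mpr (abs_pos.mpr hK)
  set σ := Real.sign K with hσ
  have hσ2 : σ * σ = 1 := by
    rcases hK.lt_or_gt with h | h
    · rw [hσ, Real.sign_of_neg h]; ring
    · rw [hσ, Real.sign_of_pos h]; ring
  have hKσ : K = σ * k ^ 2 := by
    rw [hk2]
    rcases hK.lt_or_gt with h | h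
    · rw [hσ, Real.sign_of_neg h, abs_of_neg h]; ring
    · rw [hσ, Real.sign_of_pos h, abs_of_pos h]; ring
  set a := k * x.1.1 with ha
  set b := k • x.1.2 with hb
  obtain ⟨s, hs, hsa⟩ : ∃ s : ℝ, s * s = 1 ∧ a = s * |a| := by
    rcases le_total 0 a with h | h
    · exact ⟨1, by ring, by rw [abs_of_nonneg h]; ring⟩
    · exact ⟨-1, by ring, by rw [abs_of_nonpos h]; ring⟩
  set e := |a| with he
  have he0 : 0 ≤ e := abs_nonneg a
  have hbb : inner ℝ b b = σ * (1 - e ^ 2) := by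
    have h1 := mul_form_self hK x
    rw [form, ← hσ] at h1
    have h2 : inner ℝ b b = k ^ 2 * inner ℝ x.1.2 x.1.2 := by
      rw [hb, inner_smul_left, inner_smul_right]; simp; ring
    have h3 : e ^ 2 = k ^ 2 * x.1.1 ^ 2 := by rw [he, sq_abs, ha]; ring
    rw [h2, h3]
    linear_combination σ * h1 - σ * (σ * x.1.1 * x.1.1 + inner ℝ x.1.2 x.1.2) * hKσ -
      k ^ 2 * (σ * x.1.1 * x.1.1 + inner ℝ x.1.2 x.1.2) * hσ2
  have hform : ∀ Z : Ambient d, k * form K x.1 Z = σ * (s * e) * Z.1 + inner ℝ b Z.2 := by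
    intro Z
    rw [form, ← hsa, ha, hb, inner_smul_left, ← hσ]
    simp only [RCLike.conj_to_real]
    ring
  let J : EuclideanSpace ℝ (Fin d) →ₗ[ℝ] Ambient d :=
    { toFun := fun u => (-(s * σ * inner ℝ b u), u - (σ / (1 + e) * inner ℝ b u) • b)
      map_add' := by
        intro u v
        ext1
        · simp only [inner_add_right, Prod.fst_add]; ring
        · simp only [inner_add_right, Prod.snd_add]; module
      map_smul' := by
        intro t u
        ext1
        · simp only [inner_smul_right, Prod.smul_fst, smul_eq_mul, RingHom.id_apply]; ring
        · simp only [inner_smul_right, Prod.smul_snd, RingHom.id_apply]; module }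
  have hJ : ∀ u, J u = (-(s * σ * inner ℝ b u), u - (σ / (1 + e) * inner ℝ b u) • b) :=
    fun _ => rfl
  have h1e : (1 : ℝ) + e ≠ 0 := by positivity
  refine ⟨J, fun G => G.2 - (s * G.1 + σ / (1 + e) * inner ℝ b G.2) • b, ?_, ?_, ?_, ?_⟩
  · intro u v
    rw [form, hJ, hJ]
    simp only [inner_sub_left, inner_sub_right, inner_smul_left, inner_smul_right,
      RCLike.conj_to_real, hbb, real_inner_comm b u]
    rw [← hσ]
    field_simp
    linear_combination (inner ℝ b u * inner ℝ b v * σ * (1 + e) ^ 2) * (σ * σ * hs + hσ2) +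
      (inner ℝ b u * inner ℝ b v * σ * (1 - e ^ 2)) * hσ2
  · intro u
    refine (mul_eq_zero.mp ?_).resolve_left hk0.ne'
    rw [hform, hJ]
    simp only [inner_sub_right, inner_smul_right, hbb]
    field_simp
    linear_combination (-(e * (1 + e) * inner ℝ b u)) * (σ * σ * hs + hσ2) -
      (inner ℝ b u * (1 - e ^ 2)) * hσ2
  · intro Z hZ
    have h1 : σ * (s * e) * Z.1 + inner ℝ b Z.2 = 0 := by rw [← hform, hZ, mul_zero]
    refine ⟨Z.2 - (s * Z.1 / (1 + e)) • b, ?_⟩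
    have h2 : inner ℝ b (Z.2 - (s * Z.1 / (1 + e)) • b) = -(s * σ * Z.1) := by
      rw [inner_sub_right, inner_smul_right, hbb]
      field_simp
      linear_combination (1 + e) * h1
    rw [hJ, h2]
    ext1
    · simp only
      linear_combination Z.1 * (s * s * hσ2 + hs)
    · simp only
      have : σ / (1 + e) * -(s * σ * Z.1) = -(s * Z.1 / (1 + e)) := by
        field_simp
        linear_combination -(s * Z.1) * hσ2
      rw [this]; module
  · intro G u
    rw [form, hJ]
    simp only [inner_sub_left, inner_sub_right, inner_smul_left, inner_smul_right,
      RCLike.conj_to_real, real_inner_comm G.2 b]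
    rw [← hσ]
    linear_combination (s * G.1 * inner ℝ b u) * hσ2

/-! ### Points of the space form -/

lemma pos_fst_of_form_neg (hK : K < 0) (x : SpaceForm K d) (Z : Ambient d)
    (hZ : form K Z Z < 0) (hxZ : form K x.1 Z < 0) : 0 < Z.1 := by
  obtain ⟨⟨a, b⟩, hx, hpos⟩ := x
  obtain ⟨z, v⟩ := Z
  have ha : 0 < a := hpos hK
  simp only [form, Real.sign_of_neg hK, real_inner_self_eq_norm_sq] at hx hZ hxZ ⊢
  by_contra hn
  have hz : z ≤ 0 := not_lt.mp hn
  have hK' : 1 / K < 0 := one_div_neg.mpr hK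
  have h1 : ‖b‖ ≤ a := abs_le_of_sq_le_sq' (by nlinarith) ha.le |>.2
  have h2 : ‖v‖ ≤ -z := abs_le_of_sq_le_sq' (by nlinarith) (by linarith) |>.2
  have h3 := neg_le_of_abs_le (abs_real_inner_le_norm b v)
  have h4 : ‖b‖ * ‖v‖ ≤ a * (-z) := mul_le_mul h1 h2 (norm_nonneg _) ha.le
  linarith

/-- The reversed Cauchy–Schwarz inequality on the hyperboloid. -/
lemma one_le_cosDist (hK : K < 0) (x y : SpaceForm K d) : 1 ≤ cosDist x y := by
  obtain ⟨⟨a, b⟩, hx, hpos⟩ := x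
  obtain ⟨⟨z, v⟩, hy, hpos'⟩ := y
  have ha : 0 < a := hpos hK
  have hz : 0 < z := hpos' hK
  simp only [cosDist, form, Real.sign_of_neg hK, real_inner_self_eq_norm_sq] at hx hy ⊢
  have hx' : a ^ 2 = ‖b‖ ^ 2 + (-1 / K) := by rw [neg_div]; linarith
  have hy' : z ^ 2 = ‖v‖ ^ 2 + (-1 / K) := by rw [neg_div]; linarith
  have hκ : 0 < -1 / K := div_pos_of_neg_of_neg (by norm_num) hK
  have h1 : ‖b‖ * ‖v‖ + (-1 / K) ≤ a * z := by
    refine abs_le_of_sq_le_sq' ?_ (by positivity) |>.2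
    rw [mul_pow, hx', hy']
    nlinarith [mul_nonneg hκ.le (sq_nonneg (‖b‖ - ‖v‖))]
  have h2 := le_of_abs_le (abs_real_inner_le_norm b v)
  have h3 : K * (-1 * a * z + inner ℝ b v) - 1 =
      (-K) * (a * z - inner ℝ b v - (-1 / K)) := by
    have := hK.ne
    field_simp
    ring
  have h4 : 0 ≤ (-K) * (a * z - inner ℝ b v - (-1 / K)) :=
    mul_nonneg (by linarith) (by linarith)
  linarith

lemma genArccos_le_iff {q t : ℝ} (hK : K ≠ 0) (ht : 0 ≤ t) (hKt : 0 < K → t < Real.pi)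
    (hq : K < 0 → 1 ≤ q) : genArccos K q ≤ t ↔ 0 ≤ K * (q - genCos K t) := by
  rcases hK.lt_or_gt with hK | hK
  · simp only [genArccos, genCos, if_neg hK.not_gt]
    have h1 := hq hK
    nth_rewrite 1 [← Real.arcosh_cosh ht]
    rw [Real.arcosh_le_arcosh (by linarith) (by linarith [Real.one_le_cosh t])]
    exact ⟨fun h => mul_nonneg_of_nonpos_of_nonpos hK.le (by linarith),
      fun h => by linarith [nonpos_of_mul_nonneg_right h hK]⟩
  · simp only [genArccos, genCos, if_pos hK]
    rw [mul_nonneg_iff_of_pos_left hK, sub_nonneg]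
    constructor
    · intro h
      have h1 : -1 < q := Real.arccos_lt_pi.mp (h.trans_lt (hKt hK))
      rcases le_total q 1 with h2 | h2
      · rw [← Real.cos_arccos h1.le h2]
        exact Real.cos_le_cos_of_nonneg_of_le_pi (Real.arccos_nonneg q) (hKt hK).le h
      · exact (Real.cos_le_one t).trans h2
    · intro h
      rw [← Real.arccos_cos ht (hKt hK).le]
      exact Real.arccos_le_arccos h

/-! ### The geodesic chart -/

/-- The factor that puts the point `x₀ + J u` of the tangent hyperplane on the space form. -/
noncomputable def scale (K : ℝ) (u : EuclideanSpace ℝ (Fin d)) : ℝ := (√(1 + K * ‖u‖ ^ 2))⁻¹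

/-- Gram's determinant of `u`, `w` is that of `u`, `u - w`. -/
lemma gram_le (w u : EuclideanSpace ℝ (Fin d)) :
    ‖u‖ ^ 2 * ‖w‖ ^ 2 - inner ℝ w u ^ 2 ≤ ‖u‖ ^ 2 * ‖u - w‖ ^ 2 := by
  rw [norm_sub_sq_real, real_inner_comm]
  nlinarith [sq_nonneg (‖u‖ ^ 2 - inner ℝ u w)]

lemma gram_nonneg (w u : EuclideanSpace ℝ (Fin d)) :
    0 ≤ ‖u‖ ^ 2 * ‖w‖ ^ 2 - inner ℝ w u ^ 2 := by
  have := abs_real_inner_le_norm w u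
  have h := pow_le_pow_left₀ (abs_nonneg _) this 2
  rw [sq_abs, mul_pow] at h
  linarith

/-- `r` is the radius, in the chart, of the geodesic ball whose boundary has generalized cosine
`c`. -/
structure IsChartRadius (K c r : ℝ) : Prop where
  ne : K ≠ 0
  cos_pos : 0 < c
  pos : 0 < r
  eq : K * r ^ 2 = 1 / c ^ 2 - 1

namespace IsChartRadius

variable {c r : ℝ} {u w : EuclideanSpace ℝ (Fin d)}

lemma cos_le_one (h : IsChartRadius K c r) (hK : 0 < K) : c ≤ 1 := by
  have h1 := h.eq
  have h2 := h.cos_pos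
  have h3 : 0 < K * r ^ 2 := mul_pos hK (pow_pos h.pos 2)
  have h4 : 1 < 1 / c ^ 2 := by linarith
  rw [lt_div_iff₀ (by positivity)] at h4
  nlinarith

lemma one_le_cos (h : IsChartRadius K c r) (hK : K < 0) : 1 ≤ c := by
  have h1 := h.eq
  have h2 := h.cos_pos
  have h3 : K * r ^ 2 < 0 := mul_neg_of_neg_of_pos hK (pow_pos h.pos 2)
  have h4 : 1 / c ^ 2 < 1 := by linarith
  rw [div_lt_one (by positivity)] at h4
  nlinarith

lemma one_add_pos (h : IsChartRadius K c r) (hu : ‖u‖ ≤ r) : 0 < 1 + K * ‖u‖ ^ 2 := by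
  rcases h.ne.lt_or_gt with hK | hK
  · have h1 : ‖u‖ ^ 2 ≤ r ^ 2 := by gcongr
    have h2 : 0 < 1 / c ^ 2 := by have := h.cos_pos; positivity
    have := h.eq
    nlinarith
  · positivity

lemma scale_pos (h : IsChartRadius K c r) (hu : ‖u‖ ≤ r) : 0 < scale K u :=
  inv_pos.mpr (Real.sqrt_pos.mpr (h.one_add_pos hu))

lemma scale_sq (h : IsChartRadius K c r) (hu : ‖u‖ ≤ r) :
    scale K u ^ 2 * (1 + K * ‖u‖ ^ 2) = 1 := by
  have := h.one_add_pos hu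
  rw [scale, inv_pow, Real.sq_sqrt this.le, inv_mul_cancel₀ this.ne']

lemma mul_scale_sub_nonneg (h : IsChartRadius K c r) (hu : ‖u‖ ≤ r) :
    0 ≤ K * (scale K u - c) := by
  have h1 := h.scale_pos hu
  have h2 := h.cos_pos
  have h3 := h.scale_sq hu
  have h4 : K * r ^ 2 * c ^ 2 = 1 - c ^ 2 := by rw [h.eq]; field_simp
  have h5 : ‖u‖ ^ 2 ≤ r ^ 2 := by gcongr
  have e : K * (scale K u - c) * (scale K u + c) =
      scale K u ^ 2 * c ^ 2 * (K ^ 2 * (r ^ 2 - ‖u‖ ^ 2)) := by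
    linear_combination (-(K * scale K u ^ 2)) * h4 + (K * c ^ 2) * h3
  refine nonneg_of_mul_nonneg_left ?_ (by positivity : 0 < scale K u + c)
  rw [e]
  have : 0 ≤ r ^ 2 - ‖u‖ ^ 2 := by linarith
  positivity

lemma mul_one_sub_scale_nonneg (h : IsChartRadius K c r) (hu : ‖u‖ ≤ r) :
    0 ≤ K * (1 - scale K u) := by
  have h1 := h.scale_pos hu
  have h3 := h.scale_sq hu
  have e : K * (1 - scale K u) * (1 + scale K u) = scale K u ^ 2 * (K ^ 2 * ‖u‖ ^ 2) := by
    linear_combination (-K) * h3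
  refine nonneg_of_mul_nonneg_left ?_ (by positivity : 0 < 1 + scale K u)
  rw [e]
  positivity

lemma min_le_scale (h : IsChartRadius K c r) (hu : ‖u‖ ≤ r) : min c 1 ≤ scale K u := by
  rcases h.ne.lt_or_gt with hK | hK
  · exact min_le_of_right_le (by nlinarith [h.mul_one_sub_scale_nonneg hu])
  · exact min_le_of_left_le (by nlinarith [h.mul_scale_sub_nonneg hu])

lemma scale_le_max (h : IsChartRadius K c r) (hu : ‖u‖ ≤ r) : scale K u ≤ max c 1 := by
  rcases h.ne.lt_or_gt with hK | hK
  · exact le_max_of_le_left (by nlinarith [h.mul_scale_sub_nonneg hu])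
  · exact le_max_of_le_right (by nlinarith [h.mul_one_sub_scale_nonneg hu])

lemma norm_le_of_cos (h : IsChartRadius K c r) {q : ℝ} (hq : 0 < q) (hqc : 0 ≤ K * (q - c))
    (hu : K * ‖u‖ ^ 2 = 1 / q ^ 2 - 1) : ‖u‖ ≤ r := by
  have h2 := h.cos_pos
  have hK2 : 0 < K ^ 2 := by have := h.ne; positivity
  have e : K ^ 2 * (r ^ 2 - ‖u‖ ^ 2) = K * (q - c) * ((q + c) / (c ^ 2 * q ^ 2)) := by
    have : K ^ 2 * (r ^ 2 - ‖u‖ ^ 2) = K * ((1 / c ^ 2 - 1) - (1 / q ^ 2 - 1)) := by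
      rw [← hu, ← h.eq]; ring
    rw [this]; field_simp; ring
  have h3 : 0 ≤ K ^ 2 * (r ^ 2 - ‖u‖ ^ 2) := by rw [e]; positivity
  have h4 : 0 ≤ r ^ 2 - ‖u‖ ^ 2 := nonneg_of_mul_nonneg_right h3 hK2
  exact abs_le_of_sq_le_sq' (by linarith) h.pos.le |>.2

lemma scale_eq_of_cos {q : ℝ} (hq : 0 < q) (hu : K * ‖u‖ ^ 2 = 1 / q ^ 2 - 1) :
    scale K u = q := by
  rw [scale, hu, add_sub_cancel, one_div, Real.sqrt_inv, Real.sqrt_sq hq.le, inv_inv]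

/-- The squared generalized sine of the distance of two points, in terms of the chart: the squared
coordinate distance, corrected by Gram's determinant of the coordinates. -/
lemma one_sub_cos_sq (h : IsChartRadius K c r) (hw : ‖w‖ ≤ r) (hu : ‖u‖ ≤ r) :
    1 - (scale K w * scale K u * (1 + K * inner ℝ w u)) ^ 2 =
      K * (scale K w ^ 2 * scale K u ^ 2 *
        (‖u - w‖ ^ 2 + K * (‖u‖ ^ 2 * ‖w‖ ^ 2 - inner ℝ w u ^ 2))) := by
  have h1 := h.scale_sq hw
  have h2 := h.scale_sq hu
  rw [norm_sub_sq_real, real_inner_comm]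
  linear_combination (-(scale K u ^ 2 * (1 + K * ‖u‖ ^ 2))) * h1 - h2

lemma abs_one_sub_cos_sq_bounds (h : IsChartRadius K c r) (hw : ‖w‖ ≤ r) (hu : ‖u‖ ≤ r) :
    (min c 1) ^ 4 * (|K| * ‖u - w‖ ^ 2) ≤
        |1 - (scale K w * scale K u * (1 + K * inner ℝ w u)) ^ 2| ∧
      |1 - (scale K w * scale K u * (1 + K * inner ℝ w u)) ^ 2| ≤
        (max c 1) ^ 4 * (|K| * ‖u - w‖ ^ 2) := by
  have hmin0 : 0 < min c 1 := lt_min h.cos_pos one_pos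
  have hmin1 : min c 1 ≤ 1 := min_le_right _ _
  have hmax1 : 1 ≤ max c 1 := le_max_right _ _
  rw [h.one_sub_cos_sq hw hu, abs_mul]
  set N := scale K w with hN
  set n := scale K u with hn
  have hN0 : 0 < N := h.scale_pos hw
  have hn0 : 0 < n := h.scale_pos hu
  have a1 : min c 1 ≤ N := h.min_le_scale hw
  have a2 : min c 1 ≤ n := h.min_le_scale hu
  have a3 : N ≤ max c 1 := h.scale_le_max hw
  have a4 : n ≤ max c 1 := h.scale_le_max hu
  have hP := h.scale_sq hu
  rw [← hn] at hP
  set m := min c 1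
  set M := max c 1
  set δ := ‖u - w‖ ^ 2 with hδ
  have hδ0 : 0 ≤ δ := sq_nonneg _
  have g0 := gram_nonneg w u
  have g1 := gram_le w u
  set γ := ‖u‖ ^ 2 * ‖w‖ ^ 2 - inner ℝ w u ^ 2
  have b1 : m ^ 4 * δ ≤ N ^ 2 * n ^ 2 * δ := by
    have : m ^ 4 = m ^ 2 * m ^ 2 := by ring
    rw [this]; gcongr
  have b2 : N ^ 2 * n ^ 2 * δ ≤ M ^ 4 * δ := by
    have : M ^ 4 = M ^ 2 * M ^ 2 := by ring
    rw [this]; gcongr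
  have b3 : m ^ 4 * δ ≤ N ^ 2 * δ := by
    have : m ^ 4 = m ^ 2 * m ^ 2 := by ring
    have h2 : m ^ 2 ≤ 1 := pow_le_one₀ hmin0.le hmin1
    have h3 : m ^ 2 ≤ N ^ 2 := by gcongr
    have h4 : m ^ 4 ≤ N ^ 2 := by nlinarith [sq_nonneg m]
    gcongr
  have b4 : N ^ 2 * δ ≤ M ^ 4 * δ := by
    have h2 : 1 ≤ M ^ 2 := one_le_pow₀ hmax1
    have h3 : N ^ 2 ≤ M ^ 2 := by gcongr
    have h4 : N ^ 2 ≤ M ^ 4 := by nlinarith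
    gcongr
  have b5 : N ^ 2 * n ^ 2 * (δ + K * (‖u‖ ^ 2 * δ)) = N ^ 2 * δ := by
    linear_combination N ^ 2 * δ * hP
  have hH : m ^ 4 * δ ≤ N ^ 2 * n ^ 2 * (δ + K * γ) ∧
      N ^ 2 * n ^ 2 * (δ + K * γ) ≤ M ^ 4 * δ := by
    rcases h.ne.lt_or_gt with hK | hK
    · have k1 : δ + K * γ ≤ δ := by nlinarith
      have k2 : δ + K * (‖u‖ ^ 2 * δ) ≤ δ + K * γ := by nlinarith
      have k3 : N ^ 2 * n ^ 2 * (δ + K * γ) ≤ N ^ 2 * n ^ 2 * δ := by gcongr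
      have k4 : N ^ 2 * n ^ 2 * (δ + K * (‖u‖ ^ 2 * δ)) ≤ N ^ 2 * n ^ 2 * (δ + K * γ) := by
        gcongr
      constructor <;> linarith
    · have k1 : δ ≤ δ + K * γ := by nlinarith
      have k2 : δ + K * γ ≤ δ + K * (‖u‖ ^ 2 * δ) := by nlinarith
      have k3 : N ^ 2 * n ^ 2 * δ ≤ N ^ 2 * n ^ 2 * (δ + K * γ) := by gcongr
      have k4 : N ^ 2 * n ^ 2 * (δ + K * γ) ≤ N ^ 2 * n ^ 2 * (δ + K * (‖u‖ ^ 2 * δ)) := by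
        gcongr
      constructor <;> linarith
  rw [abs_of_nonneg (le_trans (by positivity) hH.1 : 0 ≤ N ^ 2 * n ^ 2 * (δ + K * γ))]
  have hKa := abs_nonneg K
  constructor
  · calc _ = |K| * (m ^ 4 * δ) := by ring
      _ ≤ _ := mul_le_mul_of_nonneg_left hH.1 hKa
  · calc _ ≤ |K| * (M ^ 4 * δ) := mul_le_mul_of_nonneg_left hH.2 hKa
      _ = _ := by ring

/-- On the sphere, two points of the ball stay away from being antipodal. -/
lemma cos_bounds_of_pos (h : IsChartRadius K c r) (hK : 0 < K) (hw : ‖w‖ ≤ r) (hu : ‖u‖ ≤ r) :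
    2 * c ^ 2 ≤ 1 + scale K w * scale K u * (1 + K * inner ℝ w u) ∧
      scale K w * scale K u * (1 + K * inner ℝ w u) ≤ 1 := by
  have hN0 := h.scale_pos hw
  have hn0 := h.scale_pos hu
  have hP := h.scale_sq hu
  have hQ := h.scale_sq hw
  have hc := h.cos_pos
  have e := h.one_sub_cos_sq hw hu
  have hg := gram_nonneg w u
  have a1 : c ≤ scale K w := by nlinarith [h.mul_scale_sub_nonneg hw]
  have a2 : c ≤ scale K u := by nlinarith [h.mul_scale_sub_nonneg hu]
  have a3 : c ^ 2 ≤ scale K w * scale K u := by rw [sq]; gcongr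
  constructor
  · have h1 : (scale K w * scale K u * (1 - K * inner ℝ w u)) ^ 2 ≤ 1 ^ 2 := by
      have : 1 - (scale K w * scale K u * (1 - K * inner ℝ w u)) ^ 2 =
          K * (scale K w ^ 2 * scale K u ^ 2 *
            (‖u + w‖ ^ 2 + K * (‖u‖ ^ 2 * ‖w‖ ^ 2 - inner ℝ w u ^ 2))) := by
        rw [norm_add_sq_real, real_inner_comm]
        linear_combination (-(scale K u ^ 2 * (1 + K * ‖u‖ ^ 2))) * hQ - hP
      have h2 : 0 ≤ K * (scale K w ^ 2 * scale K u ^ 2 *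
            (‖u + w‖ ^ 2 + K * (‖u‖ ^ 2 * ‖w‖ ^ 2 - inner ℝ w u ^ 2))) := by positivity
      linarith
    have h2 := (abs_le_of_sq_le_sq' h1 zero_le_one).2
    nlinarith
  · have h1 : (scale K w * scale K u * (1 + K * inner ℝ w u)) ^ 2 ≤ 1 ^ 2 := by
      have h2 : 0 ≤ K * (scale K w ^ 2 * scale K u ^ 2 *
            (‖u - w‖ ^ 2 + K * (‖u‖ ^ 2 * ‖w‖ ^ 2 - inner ℝ w u ^ 2))) := by positivity
      linarith
    exact (abs_le_of_sq_le_sq' h1 zero_le_one).2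

lemma cos_le_of_neg (h : IsChartRadius K c r) (hK : K < 0) (hw : ‖w‖ ≤ r) (hu : ‖u‖ ≤ r) :
    scale K w * scale K u * (1 + K * inner ℝ w u) ≤ 2 * c ^ 2 := by
  have hN0 := h.scale_pos hw
  have hn0 := h.scale_pos hu
  have hc := h.cos_pos
  have a1 : scale K w ≤ c := by nlinarith [h.mul_scale_sub_nonneg hw]
  have a2 : scale K u ≤ c := by nlinarith [h.mul_scale_sub_nonneg hu]
  have a3 : scale K w * scale K u ≤ c ^ 2 := by rw [sq]; gcongr
  have a4 : |inner ℝ w u| ≤ r * r := (abs_real_inner_le_norm w u).trans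
    (mul_le_mul hw hu (norm_nonneg _) h.pos.le)
  have a5 := neg_le_of_abs_le a4
  have a6 : 0 < 1 / c ^ 2 := by positivity
  have a7 : 1 + K * inner ℝ w u ≤ 2 := by nlinarith [h.eq]
  calc _ ≤ scale K w * scale K u * 2 := by gcongr
    _ ≤ c ^ 2 * 2 := by gcongr
    _ = _ := by ring

lemma abs_scale_div_sub_one_le (h : IsChartRadius K c r) (hw : ‖w‖ ≤ r) (hu : ‖u‖ ≤ r) :
    |scale K u / scale K w - 1| ≤ (max c 1) ^ 4 * |K| * r / (min c 1) ^ 2 * ‖u - w‖ := by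
  have hmin0 : 0 < min c 1 := lt_min h.cos_pos one_pos
  have hP := h.scale_sq hu
  have hQ := h.scale_sq hw
  have hN0 := h.scale_pos hw
  have hn0 := h.scale_pos hu
  have a1 := h.min_le_scale hw
  have a2 := h.min_le_scale hu
  have a3 := h.scale_le_max hw
  have a4 := h.scale_le_max hu
  have hr := h.pos
  set N := scale K w
  set n := scale K u
  set m := min c 1
  set M := max c 1
  have e : (n / N - 1) * (N * (n + N)) = n ^ 2 * N ^ 2 * K * ((‖w‖ - ‖u‖) * (‖w‖ + ‖u‖)) := by
    have : (n / N - 1) * (N * (n + N)) = n ^ 2 - N ^ 2 := by field_simp; ring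
    rw [this]
    linear_combination N ^ 2 * hP - n ^ 2 * hQ
  have e2 : |n / N - 1| * (N * (n + N)) ≤ M ^ 4 * |K| * (‖u - w‖ * (2 * r)) := by
    have e3 : |n / N - 1| * (N * (n + N)) = n ^ 2 * N ^ 2 * |K| * (|‖w‖ - ‖u‖| * (‖w‖ + ‖u‖)) := by
      rw [← abs_of_pos (by positivity : 0 < N * (n + N)), ← abs_mul, e]
      simp only [abs_mul, abs_pow, abs_of_pos hN0, abs_of_pos hn0,
        abs_of_nonneg (by positivity : 0 ≤ ‖w‖ + ‖u‖)]
    rw [e3]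
    have k1 : |‖w‖ - ‖u‖| ≤ ‖u - w‖ := by
      rw [norm_sub_rev]; exact abs_norm_sub_norm_le w u
    have k2 : M ^ 4 = M ^ 2 * M ^ 2 := by ring
    rw [k2]
    have k3 : ‖w‖ + ‖u‖ ≤ 2 * r := by linarith
    have hM : 0 < M := lt_of_lt_of_le hN0 a3
    gcongr
  have e4 : |n / N - 1| * (m * (m + m)) ≤ |n / N - 1| * (N * (n + N)) := by gcongr
  have : M ^ 4 * |K| * r / m ^ 2 * ‖u - w‖ = M ^ 4 * |K| * (‖u - w‖ * (2 * r)) / (m * (m + m)) := by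
    field_simp; ring
  rw [this, le_div_iff₀ (by positivity)]
  exact e4.trans e2

end IsChartRadius

lemma exists_isChartRadius {R : ℝ} (hK : K ≠ 0) (hR : 0 < R)
    (hKR : 0 < K → R < Real.pi / (2 * √K)) :
    ∃ r, IsChartRadius K (genCos K (√|K| * R)) r ∧ (0 < K → √|K| * R < Real.pi) := by
  have hk : 0 < √|K| * R := mul_pos (Real.sqrt_pos.mpr (abs_pos.mpr hK)) hR
  have hlt : 0 < K → √|K| * R < Real.pi / 2 := by
    intro h
    have h1 := hKR h
    have hs : 0 < √K := Real.sqrt_pos.mpr h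
    rw [lt_div_iff₀ (by positivity)] at h1
    rw [abs_of_pos h]
    linarith
  have hp := Real.pi_pos
  have hc : 0 < genCos K (√|K| * R) ∧ 0 < (1 / genCos K (√|K| * R) ^ 2 - 1) / K := by
    rcases hK.lt_or_gt with h | h
    · simp only [genCos, if_neg h.not_gt]
      have h1 : 1 < Real.cosh (√|K| * R) := Real.one_lt_cosh.mpr hk.ne'
      refine ⟨by linarith, div_pos_of_neg_of_neg ?_ h⟩
      rw [sub_neg, div_lt_one (by positivity)]
      nlinarith
    · simp only [genCos, if_pos h]
      have h0 : 0 < Real.cos (√|K| * R) :=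
        Real.cos_pos_of_mem_Ioo ⟨by linarith, hlt h⟩
      have h1 : Real.cos (√|K| * R) < 1 := by
        rw [← Real.cos_zero]
        exact Real.cos_lt_cos_of_nonneg_of_le_pi le_rfl (by linarith [hlt h]) hk
      refine ⟨h0, div_pos ?_ h⟩
      rw [sub_pos, lt_div_iff₀ (by positivity)]
      nlinarith
  refine ⟨√((1 / genCos K (√|K| * R) ^ 2 - 1) / K),
    ⟨hK, hc.1, Real.sqrt_pos.mpr hc.2, ?_⟩, fun h => by linarith [hlt h]⟩
  rw [Real.sq_sqrt hc.2.le]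
  field_simp

/-- The geodesic chart `ψ` around `x₀`, which is gnomonic projection on the sphere and the
Beltrami–Klein model in hyperbolic space, maps a Euclidean ball onto the geodesic ball. It turns
geodesics into line segments; hence `⟨G, Exp_w⁻¹(u)⟩` is, up to a positive factor `φ w u` that does
not depend on `G`, a linear function of the coordinate difference `u - w`. The constants depend on
the curvature and the radius only. -/
theorem exists_chart {K R : ℝ} (hK : K ≠ 0) (hR : 0 < R)
    (hKR : 0 < K → R < Real.pi / (2 * √K)) :
    ∃ r c₁ c₂ c₃ c₄ c₅ : ℝ, 0 < r ∧ 0 < c₁ ∧ 0 < c₂ ∧ 0 < c₃ ∧ 0 < c₄ ∧ 0 < c₅ ∧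
      ∀ (d : ℕ) (x₀ : SpaceForm K d), ∃ (ψ : EuclideanSpace ℝ (Fin d) → SpaceForm K d)
        (φ : EuclideanSpace ℝ (Fin d) → EuclideanSpace ℝ (Fin d) → ℝ)
        (adj : EuclideanSpace ℝ (Fin d) → Ambient d → EuclideanSpace ℝ (Fin d)),
        (∀ u, ‖u‖ ≤ r → ψ u ∈ closedBall x₀ R) ∧
        (∀ x ∈ closedBall x₀ R, ∃ u, ‖u‖ ≤ r ∧ ψ u = x) ∧
        (∀ w, adj w 0 = 0) ∧
        ∀ w u, ‖w‖ ≤ r → ‖u‖ ≤ r →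
          (∀ G, IsTangent (ψ w) G →
            form K G (logMap (ψ w) (ψ u)) = φ w u * inner ℝ (adj w G) (u - w)) ∧
          c₁ ≤ φ w u ∧ φ w u ≤ c₂ ∧ |φ w u - 1| ≤ c₃ * ‖u - w‖ ∧
          c₄ * ‖u - w‖ ^ 2 ≤ gdist (ψ w) (ψ u) ^ 2 ∧
          gdist (ψ w) (ψ u) ^ 2 ≤ c₅ * ‖u - w‖ ^ 2 := by
  obtain ⟨r, h, hpi⟩ := exists_isChartRadius hK hR hKR
  set k := √|K| with hk
  have hk2 : k ^ 2 = |K| := Real.sq_sqrt (abs_nonneg K)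
  have hk0 : 0 < k := Real.sqrt_pos.mpr (abs_pos.mpr hK)
  set c := genCos K (k * R) with hc
  obtain ⟨s₁, s₂, s₃, hs1, hs1', hs2, hs3, hs⟩ :=
    exists_genSin_bounds K c hK h.cos_pos h.cos_le_one h.one_le_cos
  have hm : 0 < min c 1 := lt_min h.cos_pos one_pos
  have hM : 0 < max c 1 := lt_of_lt_of_le one_pos (le_max_right _ _)
  have hr := h.pos
  have hKa : 0 < |K| := abs_pos.mpr hK
  set m := min c 1 with hm_def
  set M := max c 1 with hM_def
  refine ⟨r, s₁ * (m / M), s₂ * (M / m),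
    s₃ * (s₂ * (M ^ 2 * k)) * (M / m) + M ^ 4 * |K| * r / m ^ 2,
    s₁ ^ 2 * m ^ 4, s₂ ^ 2 * M ^ 4, hr, by positivity, by positivity, by positivity, by positivity,
    by positivity, ?_⟩
  intro d x₀
  obtain ⟨J, A, hJ, hJ0, hJs, hA⟩ := exists_frame hK x₀
  have hx0 : form K x₀.1 x₀.1 = 1 / K := x₀.2.1
  have hprod : ∀ w u, form K (x₀.1 + J w) (x₀.1 + J u) = 1 / K + inner ℝ w u := by
    intro w u
    rw [form_add_left, form_add_right, form_add_right, hx0, hJ, hJ0, form_comm, hJ0]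
    ring
  have hpt : ∀ u, ∃ x : SpaceForm K d, ‖u‖ ≤ r → x.1 = scale K u • (x₀.1 + J u) := by
    intro u
    by_cases hu : ‖u‖ ≤ r
    · have hn := h.scale_pos hu
      have hn2 := h.scale_sq hu
      have h1 : form K (scale K u • (x₀.1 + J u)) (scale K u • (x₀.1 + J u)) = 1 / K := by
        rw [form_smul_left, form_smul_right, hprod, real_inner_self_eq_norm_sq]
        field_simp
        linear_combination hn2
      refine ⟨⟨scale K u • (x₀.1 + J u), h1, fun hK' => ?_⟩, fun _ => rfl⟩
      refine pos_fst_of_form_neg hK' x₀ _ (by rw [h1]; exact one_div_neg.mpr hK') ?_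
      rw [form_smul_right, form_add_right, hx0, hJ0, add_zero]
      exact mul_neg_of_pos_of_neg hn (one_div_neg.mpr hK')
    · exact ⟨x₀, fun h' => absurd h' hu⟩
  choose ψ hψ using hpt
  have hq : ∀ {w u}, ‖w‖ ≤ r → ‖u‖ ≤ r →
      cosDist (ψ w) (ψ u) = scale K w * scale K u * (1 + K * inner ℝ w u) := by
    intro w u hw hu
    rw [cosDist, hψ w hw, hψ u hu, form_smul_left, form_smul_right, hprod]
    field_simp
  have hq0 : ∀ {u}, ‖u‖ ≤ r → cosDist x₀ (ψ u) = scale K u := by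
    intro u hu
    rw [cosDist, hψ u hu, form_smul_right, form_add_right, hx0, hJ0]
    field_simp
    ring
  have hball : ∀ x : SpaceForm K d, x ∈ closedBall x₀ R ↔ 0 ≤ K * (cosDist x₀ x - c) := by
    intro x
    have : x ∈ closedBall x₀ R ↔ genArccos K (cosDist x₀ x) / k ≤ R := Iff.rfl
    rw [this, div_le_iff₀ hk0, mul_comm R]
    exact genArccos_le_iff hK (by positivity) hpi (fun hK' => one_le_cosDist hK' _ _)
  set S : EuclideanSpace ℝ (Fin d) → EuclideanSpace ℝ (Fin d) → ℝ := fun w u =>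
    if genSin K (angle (ψ w) (ψ u)) = 0 then 1
    else angle (ψ w) (ψ u) / genSin K (angle (ψ w) (ψ u)) with hS
  refine ⟨ψ, fun w u => S w u * (scale K u / scale K w), fun w G => scale K w • A G, ?_, ?_, ?_, ?_⟩
  · intro u hu
    rw [hball, hq0 hu]
    exact h.mul_scale_sub_nonneg hu
  · intro x hx
    rw [hball] at hx
    set q := cosDist x₀ x with hqdef
    have hqpos : 0 < q := by
      rcases hK.lt_or_gt with hK' | hK'
      · exact lt_of_lt_of_le one_pos (one_le_cosDist hK' _ _)
      · have := h.cos_pos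
        nlinarith
    have hfx : form K x₀.1 x.1 = q / K := by rw [hqdef, cosDist]; field_simp
    have hxx : form K x.1 x.1 = 1 / K := x.2.1
    obtain ⟨u, hu⟩ := hJs (q⁻¹ • x.1 - x₀.1) (by
      rw [form_sub_right, form_smul_right, hfx, hx0]; field_simp; ring)
    have hx' : x.1 = q • (x₀.1 + J u) := by
      rw [hu, add_sub_cancel, smul_inv_smul₀ hqpos.ne']
    have hu2 : K * ‖u‖ ^ 2 = 1 / q ^ 2 - 1 := by
      have h1 := hprod u u
      rw [real_inner_self_eq_norm_sq] at h1
      have h2 : form K x.1 x.1 = q ^ 2 * form K (x₀.1 + J u) (x₀.1 + J u) := by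
        rw [hx', form_smul_left, form_smul_right]; ring
      rw [hxx, h1] at h2
      field_simp at h2 ⊢
      linarith
    have hur := h.norm_le_of_cos hqpos hx hu2
    refine ⟨u, hur, Subtype.ext ?_⟩
    rw [hψ u hur, hx', IsChartRadius.scale_eq_of_cos hqpos hu2]
  · intro w
    have : A 0 = 0 := by
      rw [← inner_self_eq_zero (𝕜 := ℝ), hA]
      simp [form]
    change scale K w • A 0 = 0
    rw [this, smul_zero]
  intro w u hw hu
  have hN0 := h.scale_pos hw
  have hn0 := h.scale_pos hu
  have b1 := h.min_le_scale hw
  have b2 := h.min_le_scale hu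
  have b3 := h.scale_le_max hw
  have b4 := h.scale_le_max hu
  have hbd := h.abs_one_sub_cos_sq_bounds hw hu
  have hratio := h.abs_scale_div_sub_one_le hw hu
  obtain ⟨ht0, hsn0, hsn2, hlo, hhi, hdiff⟩ := hs (cosDist (ψ w) (ψ u))
    (fun hK' => by rw [hq hw hu]; exact h.cos_bounds_of_pos hK' hw hu)
    (fun hK' => ⟨one_le_cosDist hK' _ _, by rw [hq hw hu]; exact h.cos_le_of_neg hK' hw hu⟩)
  rw [← hq hw hu, ← hsn2] at hbd
  have hSwu : S w u = if genSin K (angle (ψ w) (ψ u)) = 0 then 1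
    else angle (ψ w) (ψ u) / genSin K (angle (ψ w) (ψ u)) := rfl
  have hang : angle (ψ w) (ψ u) = genArccos K (cosDist (ψ w) (ψ u)) := rfl
  have hgd : gdist (ψ w) (ψ u) = angle (ψ w) (ψ u) / k := rfl
  have hlog : logMap (ψ w) (ψ u) = (angle (ψ w) (ψ u) / genSin K (angle (ψ w) (ψ u))) •
    ((ψ u).1 - cosDist (ψ w) (ψ u) • (ψ w).1) := rfl
  rw [← hang] at ht0 hsn0 hlo hhi hdiff hbd
  set t := angle (ψ w) (ψ u) with ht
  set sn := genSin K t with hsn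
  set N := scale K w with hN
  set n := scale K u with hn
  set δ := ‖u - w‖ with hδ
  have hδ0 : 0 ≤ δ := norm_nonneg _
  have hsnM : sn ≤ M ^ 2 * k * δ := by
    refine abs_le_of_sq_le_sq' ?_ (by positivity) |>.2
    refine hbd.2.trans_eq ?_
    rw [← hk2]; ring
  have hSlo : s₁ ≤ S w u := by
    rw [hSwu]
    split_ifs with h0
    · exact hs1'
    · rw [le_div_iff₀ (lt_of_le_of_ne hsn0 (Ne.symm h0))]; exact hlo
  have hShi : S w u ≤ s₂ := by
    rw [hSwu]
    split_ifs with h0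
    · exact hs2
    · rw [div_le_iff₀ (lt_of_le_of_ne hsn0 (Ne.symm h0))]; exact hhi
  have hS1 : |S w u - 1| ≤ s₃ * (s₂ * (M ^ 2 * k)) * δ := by
    have h1 : |S w u - 1| ≤ s₃ * t := by
      rw [hSwu]
      split_ifs with h0
      · simp only [sub_self, abs_zero]; positivity
      · have hsp : 0 < sn := lt_of_le_of_ne hsn0 (Ne.symm h0)
        rw [div_sub_one h0, abs_div, abs_of_pos hsp, div_le_iff₀ hsp, mul_assoc]
        exact hdiff
    calc |S w u - 1| ≤ s₃ * t := h1
      _ ≤ s₃ * (s₂ * (M ^ 2 * k * δ)) := by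
        have : s₂ * sn ≤ s₂ * (M ^ 2 * k * δ) := by gcongr
        exact mul_le_mul_of_nonneg_left (hhi.trans this) hs3.le
      _ = _ := by ring
  have hSpos : 0 < S w u := hs1.trans_le hSlo
  have hnN1 : m / M ≤ n / N := by gcongr
  have hnN2 : n / N ≤ M / m := by gcongr
  refine ⟨?_, ?_, ?_, ?_, ?_, ?_⟩
  · intro G hG
    have hG' : form K G (ψ w).1 = 0 := by rw [form_comm]; exact hG
    have hG0 : form K G (x₀.1 + J w) = 0 := by
      rw [hψ w hw, form_smul_right] at hG'
      exact (mul_eq_zero.mp hG').resolve_left hN0.ne'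
    have hGu : form K G (ψ u).1 = n * inner ℝ (A G) (u - w) := by
      rw [hψ u hu, form_smul_right, hA, map_sub, form_sub_right]
      rw [form_add_right] at hG0 ⊢
      linear_combination n * hG0
    change _ = S w u * (n / N) * inner ℝ (N • A G) (u - w)
    rw [hlog, form_smul_right, form_sub_right, form_smul_right, hG', hGu, inner_smul_left, hSwu]
    simp only [RCLike.conj_to_real]
    split_ifs with h0
    · -- the two points coincide, so that both sides vanish whatever the value of `0 / 0`
      have h1 : δ ^ 2 = 0 := by
        have h2 := hbd.1
        rw [h0] at h2
        have h3 : 0 < m ^ 4 * |K| := by positivity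
        have h4 : m ^ 4 * |K| * δ ^ 2 ≤ 0 := by linarith
        exact le_antisymm (nonpos_of_mul_nonpos_right h4 h3) (sq_nonneg _)
      have h2 : u - w = 0 := norm_eq_zero.mp (pow_eq_zero_iff two_ne_zero |>.mp h1)
      rw [h2]; simp
    · field_simp
      ring
  · exact mul_le_mul hSlo hnN1 (by positivity) hSpos.le
  · exact mul_le_mul hShi hnN2 (by positivity) (by linarith)
  · have e : S w u * (n / N) - 1 = (S w u - 1) * (n / N) + (n / N - 1) := by ring
    change |S w u * (n / N) - 1| ≤ _
    rw [e]
    refine (abs_add_le _ _).trans ?_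
    rw [abs_mul, abs_of_pos (by positivity : 0 < n / N), add_mul]
    refine add_le_add ?_ hratio
    calc |S w u - 1| * (n / N) ≤ (s₃ * (s₂ * (M ^ 2 * k)) * δ) * (M / m) := by gcongr
      _ = _ := by ring
  · rw [hgd, div_pow, hk2, le_div_iff₀ hKa]
    calc _ = s₁ ^ 2 * (m ^ 4 * (|K| * δ ^ 2)) := by ring
      _ ≤ s₁ ^ 2 * sn ^ 2 := by gcongr; exact hbd.1
      _ = (s₁ * sn) ^ 2 := by ring
      _ ≤ t ^ 2 := by gcongr
  · rw [hgd, div_pow, hk2, div_le_iff₀ hKa]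
    calc t ^ 2 ≤ (s₂ * sn) ^ 2 := by gcongr
      _ = s₂ ^ 2 * sn ^ 2 := by ring
      _ ≤ s₂ ^ 2 * (M ^ 4 * (|K| * δ ^ 2)) := by gcongr; exact hbd.2
      _ = _ := by ring

end Geometry

/-! ### The algorithm and its query complexity -/

section Algorithm

/-- The algorithm with internal state in `S` that starts in the state `s₀`, queries the point `q s`
in the state `s`, and moves on to the state `upd s g` on receiving the answer `g`. -/
def OracleAlgorithm.ofState {P V S : Type} (s₀ : S) (q : S → P) (upd : S → V → S) (out : S → P)
    (N : ℕ) : OracleAlgorithm P V where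
  numQueries := N
  query l := q (l.foldl upd s₀)
  output l := out (l.foldl upd s₀)

lemma OracleAlgorithm.run_ofState {P V S : Type} (s₀ : S) (q : S → P) (upd : S → V → S)
    (out : S → P) (N : ℕ) (G : P → V) :
    (OracleAlgorithm.ofState s₀ q upd out N).run G =
      out ((fun s => upd s (G (q s)))^[N] s₀) := by
  have key : ∀ k, ((OracleAlgorithm.ofState s₀ q upd out N).answers G k).foldl upd s₀ =
      (fun s => upd s (G (q s)))^[k] s₀ := by
    intro k
    induction k with
    | zero => rfl
    | succ k ih =>
      rw [OracleAlgorithm.answers, List.foldl_append, ih, Function.iterate_succ_apply']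
      simp only [List.foldl_cons, List.foldl_nil]
      congr 2
      exact congrArg q ih
  exact congrArg out (key N)

variable {E : Type} [NormedAddCommGroup E] [InnerProductSpace ℝ E]

/-- The point at which the accelerated extragradient method asks for the gradient. The state consists
of the current point `x`, the mirror point `v` and, in the second half of an iteration, the predicted
mirror point. -/
def accelQuery (l : ℝ) : E × E × Option E → E
  | (x, v, none) => (1 - l) • x + l • v
  | (x, _, some v') => (1 - l) • x + l • v'

/-- The two halves, prediction and correction, of an iteration of the accelerated extragradient
method on the ball with nearest-point map `P`. The correction step is scaled by the tilt `φ`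
between the new point and the current one. -/
noncomputable def accelUpdate (l m A c₂ : ℝ) (P : E → E) (φ : E → E → ℝ) :
    E × E × Option E → E → E × E × Option E
  | (x, v, none), g => (x, v, some (P (v - (A * l * c₂ / (1 - l)) • g)))
  | (x, v, some v'), g =>
    let z := (1 - l) • x + l • v'
    let η := A * l * φ z x / (1 - l)
    (z, P ((1 + η * m)⁻¹ • (v + (η * m) • z - η • g)), none)

variable {r c₁ c₂ c₃ c₄ c₅ L μ : ℝ} {φ D : E → E → ℝ} {f : E → ℝ} {g : E → E}

lemma norm_combo_le {l : ℝ} {x v : E} (h0 : 0 ≤ l) (h1 : l ≤ 1) (hx : ‖x‖ ≤ r) (hv : ‖v‖ ≤ r) :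
    ‖(1 - l) • x + l • v‖ ≤ r := by
  refine (norm_add_le _ _).trans ?_
  rw [norm_smul, norm_smul, Real.norm_of_nonneg h0, Real.norm_of_nonneg (by linarith)]
  nlinarith

/-- Linear convergence of the accelerated extragradient method. -/
lemma TiltedConvex.accel_iterate (h : TiltedConvex r c₁ c₂ c₃ c₄ c₅ L μ φ D f g) (hr : 0 < r)
    (hL : 0 < L) (hμ : 0 < μ) (h1 : 0 < c₁) (h2 : 0 < c₂) (h3 : 0 < c₃) (h4 : 0 < c₄) (h5 : 0 < c₅)
    {s : E} (hs : ‖s‖ ≤ r) (hgs : g s = 0) {P : E → E} (hP : IsBallProj r P)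
    {l m A Λ : ℝ} (hm : m = μ * c₄ / c₂) (hA : A = 1 / c₂ / m) (hl0 : 0 < l) (hl : l ≤ 1 / 2)
    (hΛ : 12 * (L * (4 * c₃ * c₅ * r / c₁ + c₅)) ≤ Λ) (hΛl : Λ * l ^ 2 ≤ m / 2) (k : ℕ) :
    ∃ x v, (fun st => accelUpdate l m A c₂ P φ st (g (accelQuery l st)))^[2 * k] (0, 0, none) =
      (x, v, none) ∧ ‖x‖ ≤ r ∧ ‖v‖ ≤ r ∧
      (1 + c₁ / c₂ * l) ^ k * (A * (f x - f s) + ‖v - s‖ ^ 2 / 2) ≤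
        A * (f 0 - f s) + ‖s‖ ^ 2 / 2 := by
  induction k with
  | zero => exact ⟨0, 0, rfl, by simpa using hr.le, by simpa using hr.le, by simp⟩
  | succ k ih =>
    obtain ⟨x, v, hst, hx, hv, hE⟩ := ih
    have hm0 : 0 < m := by rw [hm]; positivity
    have hA0 : 0 < A := by rw [hA]; positivity
    have hl1 : l ≤ 1 := by linarith
    set y := (1 - l) • x + l • v with hy
    set v' := P (v - (A * l * c₂ / (1 - l)) • g y) with hv'
    set z := (1 - l) • x + l • v' with hz
    set η := A * l * φ z x / (1 - l) with hη
    set vp := P ((1 + η * m)⁻¹ • (v + (η * m) • z - η • g z)) with hvp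
    have hv'r : ‖v'‖ ≤ r := (hP _).1
    have hyr : ‖y‖ ≤ r := norm_combo_le hl0.le hl1 hx hv
    have hzr : ‖z‖ ≤ r := norm_combo_le hl0.le hl1 hx hv'r
    have hvpr : ‖vp‖ ≤ r := (hP _).1
    refine ⟨z, vp, ?_, hzr, hvpr, ?_⟩
    · rw [show 2 * (k + 1) = 2 + 2 * k by ring, Function.iterate_add_apply, hst]
      rfl
    have hφ1 := h.le_tilt z x hzr hx
    have h1l : 0 < 1 - l := by linarith
    have hLip : Λ * l * (A * l * c₂ / (1 - l)) ≤ 1 := by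
      have e : Λ * l * (A * l * c₂ / (1 - l)) = Λ * l ^ 2 / (m * (1 - l)) := by
        rw [hA]; field_simp
      rw [e, div_le_one (by positivity)]
      nlinarith
    have step := extragradient_step (x := x) (v := v) (y := y) (v' := v') (z := z) (vp := vp) (s := s)
      (gy := g y) (gz := g z) (fx := f x) (fz := f z) (fs := f s) (a := 1 / c₂) (m := m)
      (Lip := Λ) (p := φ z x) (c₂ := c₂) (l := l) (A := A) (η := η) (by positivity) hm0
      (by linarith) (h.tilt_le z x hzr hx) hl0 (by linarith) hA rfl rfl hLip rfl rfl
      ((h.lipschitz_grad hr hL hμ h1 h3 h4 h5 hs hgs hzr hyr).trans (by gcongr))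
      (by
        have a1 := h.lower z x hzr hx
        have a2 : 0 ≤ μ / 2 * D z x := mul_nonneg (by positivity)
          (le_trans (by positivity) (h.le_dist z x hzr hx))
        linarith)
      (by rw [hm]; exact h.quasar hμ h1 h4 hs hgs hzr)
      ((hP _).2 _ hvpr) ((hP _).2 _ hs)
    have hrate : 1 + c₁ / c₂ * l ≤ 1 + η * m := by
      have e : η * m = φ z x / c₂ * l / (1 - l) := by rw [hη, hA]; field_simp
      rw [e]
      have : c₁ / c₂ * l ≤ φ z x / c₂ * l / (1 - l) := by
        rw [le_div_iff₀ h1l]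
        have a1 : c₁ / c₂ * l ≤ φ z x / c₂ * l := by gcongr
        have a2 : 0 ≤ c₁ / c₂ * l := by positivity
        nlinarith
      linarith
    have hpot : 0 ≤ A * (f z - f s) + ‖vp - s‖ ^ 2 / 2 := by
      have := h.min_le hμ h4 hs hgs hzr
      have : 0 ≤ f z - f s := by linarith
      positivity
    have hpow : 0 < (1 + c₁ / c₂ * l) ^ k := by positivity
    calc _ = (1 + c₁ / c₂ * l) ^ k *
          ((1 + c₁ / c₂ * l) * (A * (f z - f s) + ‖vp - s‖ ^ 2 / 2)) := by ring
      _ ≤ (1 + c₁ / c₂ * l) ^ k * ((1 + η * m) * (A * (f z - f s) + ‖vp - s‖ ^ 2 / 2)) := by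
        gcongr
      _ ≤ (1 + c₁ / c₂ * l) ^ k * (A * (f x - f s) + ‖v - s‖ ^ 2 / 2) := by gcongr
      _ ≤ _ := hE

lemma exp_le_one_add_pow {ρ : ℝ} (hρ : 0 ≤ ρ) (T : ℕ) :
    Real.exp (T * (ρ / (1 + ρ))) ≤ (1 + ρ) ^ T := by
  rw [Real.exp_nat_mul]
  refine pow_le_pow_left₀ (Real.exp_pos _).le ?_ T
  have h0 : 0 < 1 + ρ := by linarith
  have h1 := Real.one_sub_le_exp_neg (ρ / (1 + ρ))
  have h2 : 1 - ρ / (1 + ρ) = (1 + ρ)⁻¹ := by field_simp; ring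
  rw [h2, Real.exp_neg] at h1
  exact (inv_le_inv₀ h0 (Real.exp_pos _)).mp h1

/-- The number of iterations is of the order of the product that bounds the query complexity. -/
lemma two_mul_ceil_le {w q x y z : ℝ} (hw : 1 ≤ w) (hq : 0 < q) :
    ((2 * ⌈w / q * max 0 (x + y + z)⌉₊ : ℕ) : ℝ) ≤
      (2 * ((2 + |z|) / q) + 2) * (w * max 1 x * max 1 y) := by
  set a := max 1 x with ha
  set b := max 1 y with hb
  have ha1 : 1 ≤ a := le_max_left _ _
  have hb1 : 1 ≤ b := le_max_left _ _
  have hab1 : 1 ≤ a * b := one_le_mul_of_one_le_of_one_le ha1 hb1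
  have hmax : max 0 (x + y + z) ≤ (2 + |z|) * (a * b) := by
    refine max_le (by positivity) ?_
    have t1 : x ≤ a * b := (le_max_right 1 x).trans (le_mul_of_one_le_right (by linarith) hb1)
    have t2 : y ≤ a * b := (le_max_right 1 y).trans (le_mul_of_one_le_left (by linarith) ha1)
    have t3 : z ≤ |z| * (a * b) :=
      (le_abs_self z).trans (le_mul_of_one_le_right (abs_nonneg z) hab1)
    linarith
  have hceil : (⌈w / q * max 0 (x + y + z)⌉₊ : ℝ) ≤ w / q * max 0 (x + y + z) + 1 :=
    (Nat.ceil_lt_add_one (by positivity)).le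
  have hle : w / q * max 0 (x + y + z) ≤ w / q * ((2 + |z|) * (a * b)) := by gcongr
  have hwab : 1 ≤ w * a * b := by
    rw [mul_assoc]; exact one_le_mul_of_one_le_of_one_le hw hab1
  have e : w / q * ((2 + |z|) * (a * b)) = (2 + |z|) / q * (w * a * b) := by ring
  push_cast
  linarith

/-- The gap after `T` iterations, once the contraction factor has beaten the initial potential. -/
lemma TiltedConvex.gap_le (h : TiltedConvex r c₁ c₂ c₃ c₄ c₅ L μ φ D f g) (hr : 0 < r)
    (hL : 0 < L) (hμ : 0 < μ) (hμL : μ ≤ L) (h2 : 0 < c₂) (h4 : 0 < c₄) (h5 : 0 < c₅)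
    {s x v : E} (hs : ‖s‖ ≤ r) (hgs : g s = 0) (hx : ‖x‖ ≤ r) {m A ε p : ℝ} (hε : 0 < ε)
    (hm : m = μ * c₄ / c₂) (hA : A = 1 / c₂ / m) (hp0 : 0 ≤ p)
    (hp : L * (2 * c₅ * r ^ 2 + r ^ 2 * c₄ / 2) / ε ≤ p)
    (hE : p * (A * (f x - f s) + ‖v - s‖ ^ 2 / 2) ≤ A * (f 0 - f s) + ‖s‖ ^ 2 / 2) :
    f x ≤ f s + ε := by
  set B := 2 * c₅ * r ^ 2 + r ^ 2 * c₄ / 2 with hB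
  have hB0 : 0 < B := by positivity
  have hf0 := h.le_min_add hL h5 hs hgs (by simpa using hr.le : ‖(0 : E)‖ ≤ r)
  have hm0 : 0 < m := by rw [hm]; positivity
  have hA0 : 0 < A := by rw [hA]; positivity
  have hAm : r ^ 2 / 2 = A * (r ^ 2 * (μ * c₄) / 2) := by rw [hA, hm]; field_simp
  have hs2 : ‖s‖ ^ 2 ≤ r ^ 2 := by gcongr
  have hE0 : A * (f 0 - f s) + ‖s‖ ^ 2 / 2 ≤ A * (L * B) := by
    have t1 : A * (f 0 - f s) ≤ A * (2 * L * c₅ * r ^ 2) :=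
      mul_le_mul_of_nonneg_left (by linarith) hA0.le
    have t2 : A * (r ^ 2 * (μ * c₄) / 2) ≤ A * (r ^ 2 * (L * c₄) / 2) := by gcongr
    have e : A * (L * B) = A * (2 * L * c₅ * r ^ 2) + A * (r ^ 2 * (L * c₄) / 2) := by
      rw [hB]; ring
    linarith
  have hfx := h.min_le hμ h4 hs hgs hx
  have hΔ : p * (f x - f s) ≤ L * B := by
    have t0 : 0 ≤ p * (‖v - s‖ ^ 2 / 2) := by positivity
    have t1 : A * (p * (f x - f s)) ≤ A * (L * B) := by
      rw [mul_add] at hE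
      linarith
    exact le_of_mul_le_mul_left t1 hA0
  have hΔ2 : L * B / ε * (f x - f s) ≤ L * B / ε * ε := by
    rw [div_mul_cancel₀ _ hε.ne']
    exact (mul_le_mul_of_nonneg_right hp (by linarith)).trans hΔ
  have := le_of_mul_le_mul_left hΔ2 (by positivity)
  linarith

/-- The query complexity of the minimization of a tilted strongly convex function on a ball.
`ψ` translates coordinates into query points and `adj` translates answers into gradients in
the coordinates. -/
theorem exists_accel_algorithm {r c₁ c₂ c₃ c₄ c₅ : ℝ} (hr : 0 < r) (h1 : 0 < c₁) (h2 : 0 < c₂)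
    (h3 : 0 < c₃) (h4 : 0 < c₄) (h5 : 0 < c₅) :
    ∃ C : ℝ, 0 < C ∧ ∀ (E : Type) [NormedAddCommGroup E] [InnerProductSpace ℝ E] [CompleteSpace E]
      (P V : Type) (ψ : E → P) (φ : E → E → ℝ) (adj : E → V → E) (L μ ε : ℝ),
      0 < μ → μ ≤ L → 0 < ε → ∃ 𝒜 : OracleAlgorithm P V,
        (𝒜.numQueries : ℝ) ≤
          C * (√(L / μ) * max 1 (Real.log (L / μ)) * max 1 (Real.log (μ / ε))) ∧
        ∀ (D : E → E → ℝ) (f : E → ℝ) (g : E → E) (G : P → V),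
          TiltedConvex r c₁ c₂ c₃ c₄ c₅ L μ φ D f g →
          (∀ w, ‖w‖ ≤ r → adj w (G (ψ w)) = g w) → (∃ s, ‖s‖ ≤ r ∧ g s = 0) →
          ∃ z, ‖z‖ ≤ r ∧ 𝒜.run G = ψ z ∧ ∀ u, ‖u‖ ≤ r → f z ≤ f u + ε := by
  -- `Λ * L` bounds the Lipschitz constant; the summand `2 * c₄ / c₂` ensures `l ≤ 1 / 2` below
  set Λ := 12 * (4 * c₃ * c₅ * r / c₁ + c₅) + 2 * c₄ / c₂ with hΛ
  have hΛ0 : 0 < Λ := by positivity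
  set l₀ := √(c₄ / c₂ / (2 * Λ)) with hl₀
  have hl₀0 : 0 < l₀ := Real.sqrt_pos.mpr (by positivity)
  have hl₀2 : l₀ ^ 2 = c₄ / c₂ / (2 * Λ) := Real.sq_sqrt (by positivity)
  have hl₀h : l₀ ≤ 1 / 2 := by
    refine abs_le_of_sq_le_sq' ?_ (by norm_num) |>.2
    rw [hl₀2, div_le_iff₀ (by positivity), hΛ]
    have : 0 < 12 * (4 * c₃ * c₅ * r / c₁ + c₅) := by positivity
    have e : 2 * c₄ / c₂ = 2 * (c₄ / c₂) := by ring
    rw [e]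
    have : 0 < c₄ / c₂ := by positivity
    nlinarith
  set B := 2 * c₅ * r ^ 2 + r ^ 2 * c₄ / 2 with hB
  have hB0 : 0 < B := by positivity
  set ν := c₁ / c₂ / (1 + c₁ / c₂) with hν
  have hν0 : 0 < ν := by positivity
  refine ⟨2 * ((2 + |Real.log B|) / (ν * l₀)) + 2, by positivity, ?_⟩
  intro E _ _ _ P V ψ φ adj L μ ε hμ hμL hε
  have hL : 0 < L := hμ.trans_le hμL
  obtain ⟨proj, hproj⟩ := exists_isBallProj (E := E) hr
  set κ := L / μ with hκ
  have hκ1 : 1 ≤ κ := by rw [hκ, le_div_iff₀ hμ]; linarith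
  have hκ0 : 0 < κ := by linarith
  set w := √κ with hw
  have hw1 : 1 ≤ w := Real.one_le_sqrt.mpr hκ1
  have hw2 : w ^ 2 = κ := Real.sq_sqrt hκ0.le
  have hw0 : 0 < w := by linarith
  set l := l₀ / w with hl
  have hl0 : 0 < l := by positivity
  have hll : l ≤ l₀ := div_le_self hl₀0.le hw1
  set m := μ * c₄ / c₂ with hm
  set A := 1 / c₂ / m with hA
  set Θ := Real.log κ + Real.log (μ / ε) + Real.log B with hΘ
  set T := ⌈w / (ν * l₀) * max 0 Θ⌉₊ with hT
  refine ⟨OracleAlgorithm.ofState (0, 0, none) (fun st => ψ (accelQuery l st))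
    (fun st a => accelUpdate l m A c₂ proj φ st (adj (accelQuery l st) a)) (fun st => ψ st.1)
    (2 * T), ?_, ?_⟩
  · exact two_mul_ceil_le hw1 (by positivity)
  · intro D f g G h hadj hs
    obtain ⟨s, hs, hgs⟩ := hs
    have hΛl : Λ * L * l ^ 2 ≤ m / 2 := by
      have : Λ * L * l ^ 2 = m / 2 := by
        rw [hl, div_pow, hw2, hl₀2, hκ, hm]; field_simp
      exact this.le
    have hLam : 12 * (L * (4 * c₃ * c₅ * r / c₁ + c₅)) ≤ Λ * L := by
      have : 0 < 2 * c₄ / c₂ * L := by positivity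
      rw [hΛ]; linarith
    obtain ⟨x, v, hst, hx, hv, hE⟩ := h.accel_iterate hr hL hμ h1 h2 h3 h4 h5 hs hgs hproj hm hA
      hl0 (hll.trans hl₀h) hLam hΛl T
    have hrun : ∀ k, k ≤ T →
        (fun st => accelUpdate l m A c₂ proj φ st
          (adj (accelQuery l st) (G (ψ (accelQuery l st)))))^[2 * k] (0, 0, none) =
        (fun st => accelUpdate l m A c₂ proj φ st (g (accelQuery l st)))^[2 * k] (0, 0, none) := by
      intro k hk
      induction k with
      | zero => rfl
      | succ k ih =>
        have ih := ih (by omega)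
        obtain ⟨x, v, hst, hx, hv, -⟩ := h.accel_iterate hr hL hμ h1 h2 h3 h4 h5 hs hgs hproj
          hm hA hl0 (hll.trans hl₀h) hLam hΛl k
        have hl1 : l ≤ 1 := by linarith
        rw [show 2 * (k + 1) = 2 + 2 * k by ring, Function.iterate_add_apply,
          Function.iterate_add_apply, ih, hst]
        simp only [Function.iterate_succ, Function.iterate_zero, Function.comp_apply, id_eq,
          accelQuery, accelUpdate]
        rw [hadj _ (norm_combo_le hl0.le hl1 hx hv)]
        rw [hadj _ (norm_combo_le hl0.le hl1 hx (hproj _).1)]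
    refine ⟨x, hx, ?_, ?_⟩
    · rw [OracleAlgorithm.run_ofState, hrun T le_rfl, hst]
    intro u hu
    set ρ := c₁ / c₂ * l with hρ
    have hρ0 : 0 < ρ := by positivity
    have hpow : L * B / ε ≤ (1 + ρ) ^ T := by
      refine le_trans ?_ (exp_le_one_add_pow hρ0.le T)
      have e1 : L * B / ε = Real.exp Θ := by
        rw [hΘ, Real.exp_add, Real.exp_add, Real.exp_log hκ0, Real.exp_log (by positivity),
          Real.exp_log hB0, hκ]
        field_simp
      rw [e1, Real.exp_le_exp]
      have t1 : ν * l₀ / w ≤ ρ / (1 + ρ) := by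
        have : ν * l₀ / w = ρ / (1 + c₁ / c₂) := by rw [hν, hρ, hl]; ring
        rw [this]
        have : c₁ / c₂ * l ≤ c₁ / c₂ * 1 := by gcongr; linarith
        gcongr
        linarith
      have t2 : w / (ν * l₀) * max 0 Θ ≤ T := Nat.le_ceil _
      calc Θ ≤ max 0 Θ := le_max_right _ _
        _ = w / (ν * l₀) * max 0 Θ * (ν * l₀ / w) := by field_simp
        _ ≤ T * (ρ / (1 + ρ)) := by gcongr
    have hgap := h.gap_le hr hL hμ hμL h2 h4 h5 hs hgs hx hε hm hA (by positivity) hpow hE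
    exact hgap.trans (by linarith [h.min_le hμ h4 hs hgs hu])

end Algorithm

end ConstCurv

theorem mainTheorem2 (K R : ℝ) (hK : K ≠ 0) (hR : 0 < R)
    (hKR : 0 < K → R < Real.pi / (2 * √K)) :
    ∃ C : ℝ, 0 < C ∧
      ∀ (d : ℕ) (x₀ : ConstCurv.SpaceForm K d) (L μ ε : ℝ), 0 < μ → μ ≤ L → 0 < ε →
        ∃ A : ConstCurv.OracleAlgorithm (ConstCurv.closedBall x₀ R) (ConstCurv.Ambient d),
          (A.numQueries : ℝ) ≤
            C * (√(L / μ) * max 1 (Real.log (L / μ)) * max 1 (Real.log (μ / ε))) ∧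
          ∀ (F : ConstCurv.SpaceForm K d → ℝ) (G : ConstCurv.SpaceForm K d → ConstCurv.Ambient d)
            (R' : ℝ), R < R' →
            (∀ x, ConstCurv.gdist x₀ x < R' → ConstCurv.HasGradAt F x (G x)) →
            ConstCurv.IsSmoothOn L (ConstCurv.closedBall x₀ R) F G →
            ConstCurv.IsStronglyGConvexOn μ (ConstCurv.closedBall x₀ R) F G →
            (∃ xs ∈ ConstCurv.closedBall x₀ R, G xs = 0) →
            ∀ x ∈ ConstCurv.closedBall x₀ R,
              F (A.run (fun y => G y.1)).1 ≤ F x + ε := by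
  obtain ⟨r, c₁, c₂, c₃, c₄, c₅, hr, h1, h2, h3, h4, h5, hchart⟩ :=
    ConstCurv.exists_chart hK hR hKR
  obtain ⟨C, hC, halg⟩ := ConstCurv.exists_accel_algorithm hr h1 h2 h3 h4 h5
  refine ⟨C, hC, ?_⟩
  intro d x₀ L μ ε hμ hμL hε
  obtain ⟨ψ, φ, adj, hmem, hsurj, hadj0, hψ⟩ := hchart d x₀
  have hpt : ∀ u, ∃ p : ConstCurv.closedBall x₀ R, ‖u‖ ≤ r → p.1 = ψ u := by
    intro u
    by_cases hu : ‖u‖ ≤ r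
    · exact ⟨⟨ψ u, hmem u hu⟩, fun _ => rfl⟩
    · exact ⟨⟨ψ 0, hmem 0 (by simpa using hr.le)⟩, fun h => absurd h hu⟩
  choose ψ' hψ' using hpt
  obtain ⟨A, hN, hA⟩ := halg (EuclideanSpace ℝ (Fin d)) (ConstCurv.closedBall x₀ R)
    (ConstCurv.Ambient d) ψ' φ adj L μ ε hμ hμL hε
  refine ⟨A, hN, ?_⟩
  rintro F G R' hRR' hgrad hsmooth hconv ⟨xs, hxs, hGxs⟩ x hx
  have hT : ConstCurv.TiltedConvex r c₁ c₂ c₃ c₄ c₅ L μ φ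
      (fun w u => ConstCurv.gdist (ψ w) (ψ u) ^ 2) (fun u => F (ψ u))
      (fun w => adj w (G (ψ w))) := by
    have htan : ∀ w, ‖w‖ ≤ r → ConstCurv.IsTangent (ψ w) (G (ψ w)) := fun w hw =>
      (hgrad _ (lt_of_le_of_lt (hmem w hw) hRR')).1
    constructor
    · intro w u hw hu
      rw [← (hψ w u hw hu).1 _ (htan w hw)]
      exact hconv _ (hmem w hw) _ (hmem u hu)
    · intro w u hw hu
      rw [← (hψ w u hw hu).1 _ (htan w hw)]
      exact hsmooth _ (hmem w hw) _ (hmem u hu)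
    · exact fun w u hw hu => (hψ w u hw hu).2.1
    · exact fun w u hw hu => (hψ w u hw hu).2.2.1
    · exact fun w u hw hu => (hψ w u hw hu).2.2.2.1
    · exact fun w u hw hu => (hψ w u hw hu).2.2.2.2.1
    · exact fun w u hw hu => (hψ w u hw hu).2.2.2.2.2
  obtain ⟨s, hs, hsx⟩ := hsurj xs hxs
  obtain ⟨z, hz, hrun, hmin⟩ := hA _ _ _ (fun y => G y.1) hT
    (fun w hw => by simp only [hψ' w hw]) ⟨s, hs, by simp only [hsx, hGxs, hadj0]⟩
  obtain ⟨u, hu, hux⟩ := hsurj x hx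
  rw [hrun, hψ' z hz, ← hux]
  exact hmin u hu
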